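/- Let $k>2$, $d=2k-2$ and $n>d$ be integers and let $\mathbb F$ be a field. Coded symbols are regarded as linear forms on the space of data files over $\mathbb F$; $\binom{\ell}{m}=0$ unless $0\le m\le \ell$; and $\mathrm{ind}_I(x)=|\{y\in I: y\le x\}|$. **MSR cascade code.** The encoder is an $n\times d$ matrix $\Psi=[\Gamma\,|\,\Upsilon]$, $\Gamma$ being its first $k$ columns, such that any $k$ rows of $\Gamma$ and any $d$ rows of $\Psi$ are linearly independent. The message matrix is a concatenation of *segments* that form a rooted tree. A segment $P$ has a mode $m\ge 0$ and a signature $\sigma_P:[d]\to\mathbb Z$; its rows are indexed by $[d]$ and its columns by the $m$-subsets $I$ of $[d]$. The root has mode $\mu=k$ and signature $0$. A segment $P$ of mode $m$ has one child for each pair $(x,B)$ with $B\subseteq[k+1:d]$, $|B|<m$, $x\in[k+1:d]$, $x\le\max B$; the child $Q$ has mode $m-|B|-1$ and signature $\sigma_Q(i)=1+\sigma_P(i)+\mathrm{ind}_{B\cup\{i\}}(i)$. The symbols of $P$ are $v_{x,X}$ ($|X|=m$, $x\in X$) and $w_{x,Y}$ ($|Y|=m+1$, $x\in Y$), subject to $\sum_{y\in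 Y}(-1)^{\mathrm{ind}_Y(y)}w_{y,Y}=0$. Before injection the entry $P_{x,I}$ of the segment is $(-1)^{\sigma_P(x)}v_{x,I}$ if $x\in I$ and $(-1)^{\sigma_P(x)}w_{x,I\cup\{x\}}$ if $x\notin I$. The symbols at positions with $x>k$, $x\le\max I$, $I\cap[k]=\varnothing$ are set to $0$; all other symbols $v_{x,X}$ and $w_{x,Y}$, $x\ne\max Y$, of all segments are independent data symbols. To the entry $(i,I)$ of the child of $P$ with pair $(x,B)$ one adds the injected symbol $(-1)^{1+\sigma_P(i)+\mathrm{ind}_{I\cup\{i\}\cup B}(i)}P_{x,I\cup\{i\}\cup B}$ whenever $i>\max I$, $i\notin B$ and $I\cap B=\varnothing$. If $M$ is the resulting message matrix, node $h$ stores the symbols $\Psi_{h,:}M$. To repair node $f$, node $h$ sends, for each segment $P$ (after injection, of mode $m$), the symbols $\Psi_{h,:}\,P\,\Xi^{f}$, where $\Xi^{f}_{I,J}=(-1)^{\sigma_P(y)+\mathrm{ind}_I(y)}\psi_{f,y}$ if $I\setminus J=\{y\}$ and $0$ otherwise, for $|I|=m$, $|J|=m-1$. Let $\mathsf{Rep}_{h\to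 f}$ be the span of all these symbols. (The parameters of the code are $(\alpha,\beta,F)=((k-1)^k,(k-1)^{k-1},k(k-1)^k)$.) **MSR product-matrix (PM) code.** The encoder is $[\Phi\,|\,\Lambda\Phi]$ with $\Phi$ an $n\times(k-1)$ matrix and $\Lambda$ diagonal with distinct diagonal entries, such that any $2k-2$ rows of $[\Phi\,|\,\Lambda\Phi]$ and any $k-1$ rows of $\Phi$ are linearly independent. The message matrix is $\begin{bmatrix}S_1\\S_2\end{bmatrix}$ with $S_1,S_2$ symmetric $(k-1)\times(k-1)$ matrices of independent data symbols. Node $h$ stores row $h$ of $[\Phi\,|\,\Lambda\Phi]\begin{bmatrix}S_1\\S_2\end{bmatrix}$, and sends the product of this row with $\Phi_{f,:}^{T}$ to repair node $f$. For the concatenation of $N=(k-1)^{k-1}$ copies of this code (same encoder, independent messages) let $\mathsf{Rep}'_{h\to f}$ be the span of the $N$ repair symbols sent from $h$ to $f$. **Equivalence.** Two linear codes on $n$ nodes are equivalent if, after replacing each of them by a concatenation of some positive number of independent copies, one is obtained from the other by an invertible linear remapping of the message space and, for every node, an invertible linear remapping of the symbols stored in that node. **Claim.** 1. For every MSR cascade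 code as above and all distinct nodes $h,f,g$, with $\mu=k$, $$\dim(\mathsf{Rep}_{h\to f}\cap\mathsf{Rep}_{h\to g})=\sum_{m=0}^{\mu}(d-k)^{\mu-m}\left[2\binom{k-1}{m-1}-\binom{k}{m}+\binom{k-2}{m}\right].$$ 2. For every concatenation of $N=(k-1)^{k-1}$ independent copies of an MSR PM code as above and all distinct nodes $h,f,g$, $\dim(\mathsf{Rep}'_{h\to f}\cap\mathsf{Rep}'_{h\to g})=0$. 3. No MSR cascade code as above is equivalent to a concatenation of $N$ independent copies of an MSR PM code as above. -/

import Mathlib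

/-! ### Cascade codes

Nodes are indexed by `Fin n`, rows of message matrices by `Fin d`. Row `i : Fin d` is row `i + 1` in
one-based numbering, so the first `k` rows are those with `(i : ℕ) < k`.
Coded symbols are linear forms on the space of data files. -/

namespace CascadeCode

/-- The number of elements of `I` that do not exceed `x`. -/
def ind {d : ℕ} (I : Finset (Fin d)) (x : Fin d) : ℕ := (I.filter (fun y => y ≤ x)).card

/-- Injection pairs `(x, B)`: `B` and `x` lie in the last `d - k` rows and `x ≤ max B`. -/
structure IsInjectionPair (k : ℕ) {d : ℕ} (x : Fin d) (B : Finset (Fin d)) : Prop where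
  lower_set : ∀ b ∈ B, k ≤ (b : ℕ)
  lower_row : k ≤ (x : ℕ)
  le_max : ∃ b ∈ B, x ≤ b

/-- A node of the injection tree is named by the list of injection pairs leading to it from the
root, the most recent pair first. `[]` is the root, and `(x, B) :: P` is the child of `P` with
injection pair `(x, B)`. -/
abbrev Path (d : ℕ) : Type := List (Fin d × Finset (Fin d))

/-- The mode of a code segment; the root has mode `μ`. -/
def mode (μ : ℕ) {d : ℕ} : Path d → ℕ
  | [] => μ
  | p :: P => mode μ P - p.2.card - 1

/-- The paths that name a code segment of the cascade code of mode `μ`. -/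
def IsSegment (k μ : ℕ) {d : ℕ} : Path d → Prop
  | [] => True
  | p :: P => IsSegment k μ P ∧ IsInjectionPair k p.1 p.2 ∧ p.2.card < mode μ P

/-- The signature vector of a code segment; it is zero at the root. -/
def sig {d : ℕ} : Path d → Fin d → ℕ
  | [], _ => 0
  | p :: P, i => 1 + sig P i + ind (insert i p.2) i

/-- The nulled positions `(x, I)` of a message matrix: `x` is one of the last `d - k` rows,
`x ≤ max I`, and `I` contains none of the first `k` rows. -/
def IsNull (k : ℕ) {d : ℕ} (x : Fin d) (I : Finset (Fin d)) : Prop :=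
  k ≤ (x : ℕ) ∧ (∃ b ∈ I, x ≤ b) ∧ ∀ a ∈ I, k ≤ (a : ℕ)

/-- Names of the `v`-symbols and `w`-symbols of the code segments. -/
inductive Symb (d : ℕ) : Type
  | v (P : Path d) (x : Fin d) (X : Finset (Fin d)) : Symb d
  | w (P : Path d) (x : Fin d) (Y : Finset (Fin d)) : Symb d

/-- The symbols that carry data: the `v_{x,X}` with `|X| = m`, `x ∈ X` and the `w_{x,Y}` with
`|Y| = m + 1`, `x ∈ Y`, `x ≠ max Y` of the segments of mode `m`, except for the nulled ones
(`v_{x,X}` stands at position `(x, X)`, and `w_{x,Y}` at position `(x, Y \ {x})`). -/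
def Symb.IsData (k μ : ℕ) {d : ℕ} : Symb d → Prop
  | .v P x X => IsSegment k μ P ∧ X.card = mode μ P ∧ x ∈ X ∧ ¬ IsNull k x X
  | .w P x Y => IsSegment k μ P ∧ Y.card = mode μ P + 1 ∧ x ∈ Y ∧ (∃ y ∈ Y, x < y) ∧
      ¬ IsNull k x (Y.erase x)

/-- Data files: one element of `F` for each data symbol. -/
abbrev File (F : Type*) (k d μ : ℕ) : Type _ := {s : Symb d // s.IsData k μ} → F

section

variable (F : Type*) [Field F] (k μ : ℕ) {d : ℕ}

open Classical in
/-- The value of a data symbol as a linear form on data files; nulled symbols are zero. -/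
noncomputable def symb (s : Symb d) : Module.Dual F (File F k d μ) :=
  if h : s.IsData k μ then LinearMap.proj (⟨s, h⟩ : {s : Symb d // s.IsData k μ}) else 0

/-- The symbol `w_{x,Y}` for `x ∈ Y`, including the parity symbol `x = max Y`, which is determined
by `∑ y ∈ Y, (-1) ^ ind Y y * w_{y,Y} = 0`. -/
noncomputable def wSymb (P : Path d) (x : Fin d) (Y : Finset (Fin d)) :
    Module.Dual F (File F k d μ) :=
  if ∃ y ∈ Y, x < y then symb F k μ (.w P x Y)
  else -∑ y ∈ Y.erase x, (-1 : F) ^ (ind Y x + ind Y y) • symb F k μ (.w P y Y)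

/-- The entry in row `x` and column `I` of the signed determinant message matrix of segment `P`,
before injection. -/
noncomputable def rawEntry (P : Path d) (x : Fin d) (I : Finset (Fin d)) :
    Module.Dual F (File F k d μ) :=
  (-1 : F) ^ sig P x •
    (if x ∈ I then symb F k μ (.v P x I) else wSymb F k μ P x (insert x I))

/-- The entry in row `i` and column `I` of the injection matrix into a segment from its parent. -/
noncomputable def injEntry : Path d → Fin d → Finset (Fin d) → Module.Dual F (File F k d μ)
  | [], _, _ => 0
  | (x, B) :: P, i, I =>
      if (∀ j ∈ I, j < i) ∧ i ∉ B ∧ Disjoint I B then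
        (-1 : F) ^ (1 + sig P i + ind (insert i (I ∪ B)) i) •
          rawEntry F k μ P x (insert i (I ∪ B))
      else 0

/-- The entries of the code segments after injection, which make up the super-message matrix. -/
noncomputable def entry (P : Path d) (i : Fin d) (I : Finset (Fin d)) :
    Module.Dual F (File F k d μ) :=
  rawEntry F k μ P i I + injEntry F k μ P i I

end

/-- Columns of the super-message matrix: a segment `P` and a set `I` with `|I| = mode P`. -/
abbrev Col (k d μ : ℕ) : Type :=
  {c : Path d × Finset (Fin d) // IsSegment k μ c.1 ∧ c.2.card = mode μ c.1}

/-- Columns of the repair-encoder matrices of all segments: a segment `P` and a set `J` with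
`|J| = mode P - 1` (there are none for segments of mode `0`). -/
abbrev RepairCol (k d μ : ℕ) : Type :=
  {c : Path d × Finset (Fin d) // IsSegment k μ c.1 ∧ c.2.card + 1 = mode μ c.1}

section

variable {F : Type*} [Field F] {n d : ℕ}

/-- Encoder matrices `Ψ = [Γ | Υ]`, with `Γ` the first `k` columns: any `k` rows of `Γ` and any `d`
rows of `Ψ` are linearly independent. -/
structure IsEncoder (k : ℕ) (Ψ : Matrix (Fin n) (Fin d) F) : Prop where
  top : ∀ e : Fin k → Fin n, Function.Injective e →
    LinearIndependent F (fun (i : Fin k) (j : {j : Fin d // (j : ℕ) < k}) => Ψ (e i) j)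
  full : ∀ e : Fin d → Fin n, Function.Injective e →
    LinearIndependent F (fun i : Fin d => Ψ (e i))

variable (k μ : ℕ) (Ψ : Matrix (Fin n) (Fin d) F)

/-- The symbol at index `I` of the codeword segment of node `h` for segment `P`. -/
noncomputable def segContent (h : Fin n) (P : Path d) (I : Finset (Fin d)) :
    Module.Dual F (File F k d μ) :=
  ∑ x : Fin d, Ψ h x • entry F k μ P x I

/-- The symbols stored in node `h` of the cascade code of mode `μ`. -/
noncomputable def content (h : Fin n) (c : Col k d μ) : Module.Dual F (File F k d μ) :=
  segContent k μ Ψ h c.1.1 c.1.2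

/-- The entry in row `I` and column `J` of the repair-encoder matrix of node `f` for segment `P`. -/
def repairEncoder (f : Fin n) (P : Path d) (I J : Finset (Fin d)) : F :=
  ∑ y : Fin d, if I \ J = {y} then (-1 : F) ^ (sig P y + ind I y) * Ψ f y else 0

/-- The repair symbols that node `h` sends to the failed node `f`: the codeword segments of `h`
multiplied by the repair-encoder matrices of `f`. -/
noncomputable def repairSymbol (h f : Fin n) (c : RepairCol k d μ) :
    Module.Dual F (File F k d μ) :=
  ∑ I ∈ Finset.powersetCard (mode μ c.1.1) (Finset.univ : Finset (Fin d)),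
    repairEncoder Ψ f c.1.1 I c.1.2 • segContent k μ Ψ h c.1.1 I

end

end CascadeCode

/-! ### Product-matrix MSR codes with `d = 2k - 2` -/

namespace ProductMatrix

variable {F : Type*} [Field F] {n : ℕ} (k : ℕ)

/-- Data files: the entries of two symmetric `(k-1) × (k-1)` matrices `S 0` and `S 1`, which are
stacked to form the message matrix. -/
abbrev File (F : Type*) (k : ℕ) : Type _ := Fin 2 × Sym2 (Fin (k - 1)) → F

/-- The encoder matrix `[Φ | ΛΦ]` with `Λ = diag lam`. -/
def encoder {k : ℕ} (Φ : Matrix (Fin n) (Fin (k - 1)) F) (lam : Fin n → F) :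
    Matrix (Fin n) (Fin (k - 1) ⊕ Fin (k - 1)) F :=
  Matrix.fromCols Φ (Matrix.diagonal lam * Φ)

/-- The requirements on the encoder: any `2k - 2` rows of `[Φ | ΛΦ]` and any `k - 1` rows of `Φ`
are linearly independent, and the diagonal entries of `Λ` are distinct. -/
structure IsEncoder {k : ℕ} (Φ : Matrix (Fin n) (Fin (k - 1)) F) (lam : Fin n → F) : Prop where
  full : ∀ e : Fin (2 * k - 2) → Fin n, Function.Injective e →
    LinearIndependent F (fun i : Fin (2 * k - 2) => encoder Φ lam (e i))
  top : ∀ e : Fin (k - 1) → Fin n, Function.Injective e →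
    LinearIndependent F (fun i : Fin (k - 1) => Φ (e i))
  inj : Function.Injective lam

/-- The message matrix: `S 0` on top of `S 1`. -/
def message (F : Type*) [Field F] (k : ℕ) :
    Matrix (Fin (k - 1) ⊕ Fin (k - 1)) (Fin (k - 1)) (Module.Dual F (File F k))
  | .inl i, j => LinearMap.proj ((0, s(i, j)) : Fin 2 × Sym2 (Fin (k - 1)))
  | .inr i, j => LinearMap.proj ((1, s(i, j)) : Fin 2 × Sym2 (Fin (k - 1)))

variable {k} (Φ : Matrix (Fin n) (Fin (k - 1)) F) (lam : Fin n → F)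

/-- The `k - 1` symbols stored in node `h`. -/
def content (h : Fin n) (j : Fin (k - 1)) : Module.Dual F (File F k) :=
  ∑ i, encoder Φ lam h i • message F k i j

/-- The one repair symbol that node `h` sends to the failed node `f`: the content of `h` times the
row of `Φ` that belongs to `f`. -/
def repairSymbol (h f : Fin n) (_ : Unit) : Module.Dual F (File F k) :=
  ∑ j, Φ f j • content Φ lam h j

end ProductMatrix

/-! ### Concatenation and equivalence of linear codes

A linear code with message space `V` is given by the symbols `C i j`, `j : κ`, stored in node `i`,
as linear forms on `V`. -/

namespace LinearCode

variable {F : Type*} [Field F] {n : ℕ} {V W κ κ' : Type*} [AddCommGroup V] [Module F V]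
  [AddCommGroup W] [Module F W]

/-- The symbols of a concatenation of `N` copies of a code with independent messages. -/
def copies (N : ℕ) (s : κ → Module.Dual F V) : Fin N × κ → Module.Dual F (Fin N → V) :=
  fun p => (s p.2).comp (LinearMap.proj p.1)

/-- Some invertible remapping of the message and, for each node, some invertible remapping of the
symbols stored in that node, turn `C` into `C'`. -/
def Remapped (C : Fin n → κ → Module.Dual F V) (C' : Fin n → κ' → Module.Dual F W) : Prop :=
  ∃ (T : V ≃ₗ[F] W) (S : Fin n → ((κ → F) ≃ₗ[F] (κ' → F))),
    ∀ (i : Fin n) (v : V), S i (fun j => C i j v) = fun j => C' i j (T v)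

/-- Equivalence of linear codes: after scaling the parameters of both codes by positive integers
(by concatenating independent copies), one is a remapping of the other. -/
def Equivalent (C : Fin n → κ → Module.Dual F V) (C' : Fin n → κ' → Module.Dual F W) : Prop :=
  ∃ a b : ℕ, 0 < a ∧ 0 < b ∧
    Remapped (fun i => copies a (C i)) (fun i => copies b (C' i))

end LinearCode

/-- The binomial coefficient, zero unless `0 ≤ m ≤ l`. -/
def binom (l m : ℤ) : ℤ := if 0 ≤ m ∧ m ≤ l then (l.toNat.choose m.toNat : ℤ) else 0

/-! Order the columns of the cascade message matrix by `colRank`. Every entry in a row beyond the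
first `k` is a combination of entries in the first `k` rows of strictly earlier columns
(`entry_bottom_mem`), so a file decodes column by column from any `k` nodes. Counting data symbols
against top positions (`card_top_le`) makes this decoding bijective. Hence the contents of `k` nodes
can be prescribed freely (`contentMap_surjective`), and the symbols of one node are independent
(`comb_injOn`).

First claim. By this independence the repair spaces may be computed on coefficient vectors. In a
segment of mode `m` these live in degree `m` of an exterior algebra, and the repair encoder of `f`
is exterior multiplication by the signed row of `f`. Its image is its kernel, by contraction with a
dual vector, so two repair spaces meet in the common kernel of two multiplications, of dimension
`doubleDim d m` (`finrank_homog_inf_ker_inf_ker`). With `t = d - k`, the generating function of the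
tree is `1 / ((1 + X)^t (1 - t X))`; it turns `X^2 (1 + X)^(d-2)` into `X^2 (1 + X)^(k-2) / (1 - t
X)`, whose coefficient in degree `k` is the stated sum.

Second claim. The symbols of a product-matrix node are independent, and the rows of `Φ` for two
nodes are not proportional.

Third claim. Equivalence does not mention repair, so this does not follow from the dimensions. The
product-matrix code has two files, `a aᵀ` in either block, whose contents in node `h` differ by the
factor `lam h`; `a` can be chosen so that both vanish on a set `C` of `k - 2` nodes. In the cascade
code, their first nonzero column gives top vectors `E`, `G` with `topRow h ⬝ᵥ E = lam h * (topRow h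
⬝ᵥ G)`. Files leading with `E` or `G` in a suitable column are sent back and read through the repair
of a node `c ∈ C`. This gives `Φ h ⬝ᵥ x = lam h * (Φ h ⬝ᵥ y)` for all `h ≠ c`. As there are at least
`2k - 2` such nodes, `x = y = 0`; then `G` is orthogonal to one more top row, and
`IsEncoder.eq_zero_of_pencil` forces `E = G = 0`, a contradiction. -/

namespace CascadeCode

open Finset

/-! ### Triangular structure of the message matrix -/

section Structure

variable (F : Type*) [Field F] (k μ : ℕ) {d : ℕ}

/-- The scale that makes the mode the leading part of `colRank`. -/
def rankScale (d : ℕ) : ℕ := ∑ i : Fin d, (i : ℕ) + 1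

/-- The decoding order of columns: first by mode, then by the sum of the rows outside the index. -/
def colRank (P : Path d) (I : Finset (Fin d)) : ℕ :=
  mode μ P * rankScale d + ∑ i ∈ Iᶜ, (i : ℕ)

/-- The span of the entries in the first `k` rows of the columns of rank less than `r`. -/
def lower (d r : ℕ) : Submodule F (Module.Dual F (File F k d μ)) :=
  Submodule.span F {φ | ∃ (P : Path d) (I : Finset (Fin d)) (y : Fin d), IsSegment k μ P ∧
    I.card = mode μ P ∧ (y : ℕ) < k ∧ colRank μ P I < r ∧ φ = entry F k μ P y I}

variable {k μ}

lemma mode_mul_le_colRank (P : Path d) (I : Finset (Fin d)) :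
    mode μ P * rankScale d ≤ colRank μ P I := Nat.le_add_right _ _

lemma colRank_lt (P : Path d) (I : Finset (Fin d)) :
    colRank μ P I < (mode μ P + 1) * rankScale d := by
  have : ∑ i ∈ Iᶜ, (i : ℕ) ≤ ∑ i : Fin d, (i : ℕ) :=
    Finset.sum_le_sum_of_subset (Finset.subset_univ _)
  unfold colRank
  rw [add_mul, one_mul]
  have h : rankScale d = ∑ i : Fin d, (i : ℕ) + 1 := rfl
  omega

/-- The complement of the index trades `x` for the smaller `y`. This is why parities are decoded
after the other members of their parity group. -/
lemma colRank_swap_lt (P : Path d) {x y : Fin d} {I : Finset (Fin d)} (hx : x ∉ I) (hy : y ∈ I)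
    (hyx : y < x) : colRank μ P ((insert x I).erase y) < colRank μ P I := by
  unfold colRank
  have h1 : ((insert x I).erase y)ᶜ = insert y (Iᶜ.erase x) := by
    ext z
    simp only [mem_compl, mem_erase, mem_insert]
    constructor
    · intro h
      by_cases hz : z = y
      · exact Or.inl hz
      · refine Or.inr ⟨fun h' => h ⟨hz, Or.inl h'⟩, fun h' => h ⟨hz, Or.inr h'⟩⟩
    · rintro (rfl | ⟨h1, h2⟩) ⟨h3, h4⟩
      · exact h3 rfl
      · rcases h4 with h4 | h4
        · exact h1 h4
        · exact h2 h4
  have h2 : y ∉ Iᶜ.erase x := by simp [hy]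
  have h3 := Finset.add_sum_erase Iᶜ (fun i : Fin d => (i : ℕ)) (mem_compl.mpr hx)
  rw [h1, Finset.sum_insert h2]
  have : (y : ℕ) < x := hyx
  omega

variable {F}

lemma lower_mono {r s : ℕ} (h : r ≤ s) : lower F k μ d r ≤ lower F k μ d s := by
  apply Submodule.span_mono
  rintro φ ⟨P, I, y, h1, h2, h3, h4, h5⟩
  exact ⟨P, I, y, h1, h2, h3, h4.trans_le h, h5⟩

lemma entry_mem_lower {P : Path d} {I : Finset (Fin d)} {y : Fin d} {r : ℕ}
    (hP : IsSegment k μ P) (hI : I.card = mode μ P) (hy : (y : ℕ) < k)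
    (hr : colRank μ P I < r) : entry F k μ P y I ∈ lower F k μ d r :=
  Submodule.subset_span ⟨P, I, y, hP, hI, hy, hr, rfl⟩

lemma neg_one_pow_smul_mem_iff {V : Type*} [AddCommGroup V] [Module F V] (S : Submodule F V)
    (e : ℕ) (v : V) : (-1 : F) ^ e • v ∈ S ↔ v ∈ S :=
  S.smul_mem_iff (pow_ne_zero _ (neg_ne_zero.mpr one_ne_zero))

lemma injEntry_eq_zero (P : Path d) {i : Fin d} {I : Finset (Fin d)} (h : ∃ j ∈ I, i ≤ j) :
    injEntry F k μ P i I = 0 := by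
  obtain ⟨j, hj, hij⟩ := h
  cases P with
  | nil => rfl
  | cons p P =>
    obtain ⟨x, B⟩ := p
    simp only [injEntry]
    rw [if_neg]
    rintro ⟨h, -⟩
    exact absurd (h j hj) (not_lt.mpr hij)

lemma entry_eq_rawEntry (P : Path d) {i : Fin d} {I : Finset (Fin d)} (h : ∃ j ∈ I, i ≤ j) :
    entry F k μ P i I = rawEntry F k μ P i I := by
  rw [entry, injEntry_eq_zero P h, add_zero]

lemma rawEntry_of_mem (P : Path d) {x : Fin d} {I : Finset (Fin d)} (hx : x ∈ I) :
    rawEntry F k μ P x I = (-1 : F) ^ sig P x • symb F k μ (.v P x I) := by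
  rw [rawEntry, if_pos hx]

lemma rawEntry_erase (P : Path d) {x : Fin d} {Y : Finset (Fin d)} (hx : x ∈ Y)
    (h : ∃ y ∈ Y, x < y) :
    rawEntry F k μ P x (Y.erase x) = (-1 : F) ^ sig P x • symb F k μ (.w P x Y) := by
  rw [rawEntry, if_neg (by simp), Finset.insert_erase hx, wSymb, if_pos h]

lemma rawEntry_of_notMem (P : Path d) {x : Fin d} {I : Finset (Fin d)} (hx : x ∉ I)
    (h : ∃ y ∈ I, x ≤ y) :
    rawEntry F k μ P x I = (-1 : F) ^ sig P x • symb F k μ (.w P x (insert x I)) := by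
  have := rawEntry_erase (F := F) (k := k) (μ := μ) P (Finset.mem_insert_self x I) (by
    obtain ⟨y, hy, hxy⟩ := h
    exact ⟨y, Finset.mem_insert_of_mem hy, lt_of_le_of_ne hxy (by rintro rfl; exact hx hy)⟩)
  rwa [Finset.erase_insert hx] at this

/-- As `x` exceeds all of `I`, the symbol here is the parity of the group `insert x I`, a signed sum
of the other members. -/
lemma rawEntry_parity_mem (S : Submodule F (Module.Dual F (File F k d μ))) (P : Path d) {x : Fin d}
    {I : Finset (Fin d)} (hx : ∀ y ∈ I, y < x)
    (h : ∀ y ∈ I, rawEntry F k μ P y ((insert x I).erase y) ∈ S) :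
    rawEntry F k μ P x I ∈ S := by
  have hxI : x ∉ I := fun h => lt_irrefl _ (hx x h)
  rw [rawEntry, if_neg hxI, neg_one_pow_smul_mem_iff, wSymb, if_neg]
  · rw [Finset.erase_insert hxI]
    refine S.neg_mem (S.sum_mem fun y hy => (neg_one_pow_smul_mem_iff S _ _).mpr ?_)
    have := h y hy
    rwa [rawEntry_erase P (Finset.mem_insert_of_mem hy) ⟨x, Finset.mem_insert_self _ _, hx y hy⟩,
      neg_one_pow_smul_mem_iff] at this
  · rintro ⟨y, hy, hxy⟩
    rcases Finset.mem_insert.mp hy with rfl | hy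
    · exact lt_irrefl _ hxy
    · exact lt_asymm hxy (hx y hy)

lemma rawEntry_top_mem {P : Path d} {I : Finset (Fin d)} {y : Fin d} {r : ℕ}
    (hP : IsSegment k μ P) (hI : I.card = mode μ P) (hy : (y : ℕ) < k) (h : ∃ j ∈ I, y ≤ j)
    (hr : colRank μ P I < r) : rawEntry F k μ P y I ∈ lower F k μ d r := by
  rw [← entry_eq_rawEntry P h]
  exact entry_mem_lower hP hI hy hr

lemma card_swap {x y : Fin d} {I : Finset (Fin d)} (hx : x ∉ I) (hy : y ∈ I) :
    ((insert x I).erase y).card = I.card := by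
  rw [Finset.card_erase_of_mem (Finset.mem_insert_of_mem hy), Finset.card_insert_of_notMem hx]
  rfl

lemma mem_swap {x y : Fin d} {I : Finset (Fin d)} (hx : x ∉ I) (hy : y ∈ I) :
    x ∈ (insert x I).erase y :=
  Finset.mem_erase.mpr ⟨by rintro rfl; exact hx hy, Finset.mem_insert_self _ _⟩

lemma rawEntry_eq_zero_of_isNull (P : Path d) {x : Fin d} {I : Finset (Fin d)}
    (h : IsNull k x I) : rawEntry F k μ P x I = 0 := by
  by_cases hx : x ∈ I
  · rw [rawEntry_of_mem P hx, symb, dif_neg, smul_zero]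
    exact fun h' => h'.2.2.2 h
  · rw [rawEntry_of_notMem P hx h.2.1, symb, dif_neg, smul_zero]
    intro h'
    have := h'.2.2.2.2
    rw [Finset.erase_insert hx] at this
    exact this h

/-- The bottom entries that are not parities are injected into the first `k` rows of a child. -/
lemma rawEntry_bottom_mem {P : Path d} {I : Finset (Fin d)} {x : Fin d}
    (hP : IsSegment k μ P) (hI : I.card = mode μ P) (hx : k ≤ (x : ℕ)) (h : ∃ j ∈ I, x ≤ j) :
    rawEntry F k μ P x I ∈
      lower F k μ d ((mode μ P - (I.filter fun a : Fin d => k ≤ (a : ℕ)).card) * rankScale d) := by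
  by_cases hn : IsNull k x I
  · rw [rawEntry_eq_zero_of_isNull P hn]
    exact Submodule.zero_mem _
  -- The symbol is injected into the child `(x, B)`, with `B` the bottom part of `I`, at row `i =
  -- max L` and column `L \ {i}`, with `L` the top part. `L` is nonempty because the position is not
  -- null.
  set B := I.filter fun a : Fin d => k ≤ (a : ℕ) with hB
  set L := I.filter fun a : Fin d => ¬ k ≤ (a : ℕ) with hL
  have hne : L.Nonempty := by
    by_contra hL0
    refine hn ⟨hx, h, fun a ha => ?_⟩
    by_contra hak
    exact hL0 ⟨a, Finset.mem_filter.mpr ⟨ha, hak⟩⟩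
  set i := L.max' hne with hi
  set J := L.erase i with hJ
  have hiL : i ∈ L := L.max'_mem hne
  have hik : (i : ℕ) < k := not_le.mp (Finset.mem_filter.mp hiL).2
  have hJlt : ∀ j ∈ J, j < i := fun j hj => L.lt_max'_of_mem_erase_max' hne hj
  have hcard : B.card + L.card = I.card := Finset.card_filter_add_card_filter_not _
  have hLpos : 0 < L.card := hne.card_pos
  have hJcard : J.card = L.card - 1 := Finset.card_erase_of_mem hiL
  have hQ : IsSegment k μ ((x, B) :: P) := by
    refine ⟨hP, ⟨fun b hb => (Finset.mem_filter.mp hb).2, hx, ?_⟩, ?_⟩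
    · obtain ⟨j, hj, hxj⟩ := h
      exact ⟨j, Finset.mem_filter.mpr ⟨hj, hx.trans hxj⟩, hxj⟩
    · change B.card < mode μ P
      omega
  have hmode : mode μ ((x, B) :: P) = mode μ P - B.card - 1 := rfl
  have hJmode : J.card = mode μ ((x, B) :: P) := by omega
  have hiB : i ∉ B := fun hb => absurd (Finset.mem_filter.mp hb).2 (not_le.mpr hik)
  have hdisj : Disjoint J B := by
    rw [Finset.disjoint_left]
    intro a ha hb
    exact (Finset.mem_filter.mp (Finset.mem_of_mem_erase ha)).2 (Finset.mem_filter.mp hb).2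
  have hun : insert i (J ∪ B) = I := by
    rw [← Finset.insert_union, hJ, Finset.insert_erase hiL, Finset.union_comm]
    exact Finset.filter_union_filter_not_eq _ _
  have hinj : injEntry F k μ ((x, B) :: P) i J =
      (-1 : F) ^ (1 + sig P i + ind I i) • rawEntry F k μ P x I := by
    rw [injEntry, if_pos ⟨hJlt, hiB, hdisj⟩, hun]
  rw [← neg_one_pow_smul_mem_iff _ (1 + sig P i + ind I i), ← hinj]
  have heq : injEntry F k μ ((x, B) :: P) i J =
      entry F k μ ((x, B) :: P) i J - rawEntry F k μ ((x, B) :: P) i J := by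
    rw [entry]; abel
  have hmode' : mode μ ((x, B) :: P) + 1 = mode μ P - B.card := by omega
  rw [heq, ← hmode']
  have hiJ : i ∉ J := Finset.notMem_erase _ _
  -- Before injection the child holds a parity at `(i, J)`. The rest of its group stands in top rows
  -- `y < i`, at positions that receive no injection.
  refine Submodule.sub_mem _ (entry_mem_lower hQ hJmode hik (colRank_lt _ _)) ?_
  refine rawEntry_parity_mem _ _ hJlt fun y hy => ?_
  refine rawEntry_top_mem hQ ((card_swap hiJ hy).trans hJmode) ?_ ⟨i, mem_swap hiJ hy, (hJlt y hy).le⟩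
    (colRank_lt _ _)
  exact lt_trans (hJlt y hy) hik

lemma rawEntry_mem {P : Path d} {I : Finset (Fin d)} {x : Fin d} {r : ℕ}
    (hP : IsSegment k μ P) (hI : I.card = mode μ P) (h : ∃ j ∈ I, x ≤ j)
    (hr : colRank μ P I < r) : rawEntry F k μ P x I ∈ lower F k μ d r := by
  by_cases hx : (x : ℕ) < k
  · exact rawEntry_top_mem hP hI hx h hr
  · refine lower_mono ?_ (rawEntry_bottom_mem hP hI (not_lt.mp hx) h)
    exact (Nat.mul_le_mul_right _ (Nat.sub_le _ _)).trans
      ((mode_mul_le_colRank P I).trans hr.le)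

/-- A bottom entry below the maximum of its column is recovered from a child of smaller mode.
Otherwise it is a parity, determined by columns of smaller rank in the same segment, plus an
injected symbol, which is itself a bottom entry of the parent and recoverable at low enough mode. -/
lemma entry_bottom_mem {P : Path d} {I : Finset (Fin d)} {x : Fin d}
    (hP : IsSegment k μ P) (hI : I.card = mode μ P) (hx : k ≤ (x : ℕ)) :
    entry F k μ P x I ∈ lower F k μ d (colRank μ P I) := by
  by_cases h : ∃ j ∈ I, x ≤ j
  · rw [entry_eq_rawEntry P h]
    refine lower_mono ?_ (rawEntry_bottom_mem hP hI hx h)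
    exact (Nat.mul_le_mul_right _ (Nat.sub_le _ _)).trans (mode_mul_le_colRank P I)
  · push Not at h
    have hxI : x ∉ I := fun h' => lt_irrefl _ (h x h')
    refine Submodule.add_mem _ (rawEntry_parity_mem _ _ h fun y hy => ?_) ?_
    · exact rawEntry_mem hP ((card_swap hxI hy).trans hI) ⟨x, mem_swap hxI hy, (h y hy).le⟩
        (colRank_swap_lt P hxI hy (h y hy))
    · cases P with
      | nil => exact Submodule.zero_mem _
      | cons p P =>
        obtain ⟨z, B⟩ := p
        rw [injEntry]
        split_ifs with hc
        · rw [neg_one_pow_smul_mem_iff]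
          obtain ⟨-, hxB, hd⟩ := hc
          obtain ⟨hP', hpair, hBc⟩ := hP
          have hx' : x ∉ I ∪ B := by simp [hxI, hxB]
          have hm : mode μ ((z, B) :: P) = mode μ P - B.card - 1 := rfl
          change B.card < mode μ P at hBc
          have hcard : (insert x (I ∪ B)).card = mode μ P := by
            rw [Finset.card_insert_of_notMem hx', Finset.card_union_of_disjoint hd]
            omega
          obtain ⟨b, hb, hzb⟩ := hpair.le_max
          refine lower_mono ?_ (rawEntry_bottom_mem hP' hcard hpair.lower_row
            ⟨b, by simp [show b ∈ B from hb], hzb⟩)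
          refine le_trans (Nat.mul_le_mul_right _ ?_) (mode_mul_le_colRank _ I)
          -- The bottom part of the parent's index contains `x` besides `B`, so the bound on the
          -- mode drops by `B.card + 1`, exactly to the mode of the current segment.
          have hsub : insert x B ⊆ (insert x (I ∪ B)).filter fun a : Fin d => k ≤ (a : ℕ) := by
            intro a ha
            rcases Finset.mem_insert.mp ha with rfl | ha
            · simp [hx]
            · simp [ha, hpair.lower_set a ha]
          have := Finset.card_le_card hsub
          rw [Finset.card_insert_of_notMem hxB] at this
          omega
        · exact Submodule.zero_mem _

/-- Every data symbol is a combination of entries in the first `k` rows. -/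
lemma symb_mem_lower (s : Symb d) (hs : s.IsData k μ) : ∃ r, symb F k μ s ∈ lower F k μ d r := by
  cases s with
  | v P x X =>
    obtain ⟨h1, h2, h3, -⟩ := hs
    have := rawEntry_mem (F := F) (x := x) h1 h2 ⟨x, h3, le_rfl⟩ (Nat.lt_succ_self _)
    rw [rawEntry_of_mem P h3, neg_one_pow_smul_mem_iff] at this
    exact ⟨_, this⟩
  | w P x Y =>
    obtain ⟨h1, h2, h3, h4, -⟩ := hs
    obtain ⟨y, hy, hxy⟩ := h4
    have hc : (Y.erase x).card = mode μ P := by rw [Finset.card_erase_of_mem h3]; omega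
    have := rawEntry_mem (F := F) (x := x) h1 hc
      ⟨y, Finset.mem_erase.mpr ⟨hxy.ne', hy⟩, hxy.le⟩ (Nat.lt_succ_self _)
    rw [rawEntry_erase P h3 ⟨y, hy, hxy⟩, neg_one_pow_smul_mem_iff] at this
    exact ⟨_, this⟩

/-- The top rows of the message matrix determine the data file. -/
lemma file_eq_zero (v : File F k d μ) (h : ∀ (P : Path d) (I : Finset (Fin d)) (y : Fin d),
    IsSegment k μ P → I.card = mode μ P → (y : ℕ) < k → entry F k μ P y I v = 0) : v = 0 := by
  funext s
  obtain ⟨r, hr⟩ := symb_mem_lower (F := F) s.1 s.2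
  have hv : lower F k μ d r ≤ LinearMap.ker (Module.Dual.eval F (File F k d μ) v) := by
    refine Submodule.span_le.mpr ?_
    rintro φ ⟨P, I, y, h1, h2, h3, -, rfl⟩
    exact h P I y h1 h2 h3
  have := hv hr
  rw [symb, dif_pos s.2] at this
  exact this

end Structure

end CascadeCode

/-! ### Orthogonality and independence of encoder rows -/

section LinearAlgebra

variable {F : Type*} [Field F]

/-- A vector orthogonal to a basis vanishes. -/
lemma eq_zero_of_dotProduct_eq_zero {ι κ : Type*} [Fintype ι] [Fintype κ] {R : κ → ι → F}
    (hR : LinearIndependent F R) (hc : Fintype.card κ = Fintype.card ι) {x : ι → F}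
    (hx : ∀ i, R i ⬝ᵥ x = 0) : x = 0 := by
  have hspan := hR.span_eq_top_of_card_eq_finrank' (by rw [hc, Module.finrank_fintype_fun_eq_card])
  have hle : Submodule.span F (Set.range R) ≤ LinearMap.ker ((dotProductBilin F F).flip x) := by
    refine Submodule.span_le.mpr ?_
    rintro _ ⟨i, rfl⟩
    exact hx i
  rw [hspan] at hle
  refine dotProduct_eq_zero _ fun w => ?_
  rw [dotProduct_comm]
  exact hle (Submodule.mem_top (x := w))

/-- Independence of the rows along every injection passes to independence along finite sets. -/
lemma linearIndependent_of_card_le {α V : Type*} [Fintype α] [DecidableEq α] [AddCommGroup V]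
    [Module F V] {r : ℕ} {R : α → V}
    (hR : ∀ e : Fin r → α, Function.Injective e → LinearIndependent F (fun i => R (e i)))
    (hr : r ≤ Fintype.card α) (A : Finset α) (hA : A.card ≤ r) :
    LinearIndependent F (fun i : A => R i) := by
  obtain ⟨B, hAB, -, hB⟩ := Finset.exists_subsuperset_card_eq (Finset.subset_univ A) hA
    (by rwa [Finset.card_univ])
  let e : Fin r ≃ B := (B.equivFinOfCardEq hB).symm
  have h := hR (fun i => (e i : α)) (Subtype.val_injective.comp e.injective)
  have h2 := h.comp (fun a : A => e.symm ⟨a, hAB a.2⟩) (fun a b hab => by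
    have := congrArg Subtype.val (e.symm.injective hab)
    exact Subtype.ext this)
  convert h2 using 2 with a
  simp

end LinearAlgebra

namespace CascadeCode

open Finset

/-! ### Finiteness, and data symbols against top positions -/

section Counting

variable (F : Type*) [Field F] {k μ d : ℕ}

lemma IsSegment.length_add_mode_le : ∀ {P : Path d}, IsSegment k μ P → P.length + mode μ P ≤ μ
  | [], _ => by simp [mode]
  | p :: P, h => by
    have h1 := h.1.length_add_mode_le
    have h2 : p.2.card < mode μ P := h.2.2
    simp only [List.length_cons, mode]
    omega

lemma finite_isSegment (k μ d : ℕ) : {P : Path d | IsSegment k μ P}.Finite :=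
  (List.finite_length_le (Fin d × Finset (Fin d)) μ).subset fun _ hP =>
    le_trans (Nat.le_add_right _ _) (IsSegment.length_add_mode_le hP)

instance : Finite {P : Path d // IsSegment k μ P} := finite_isSegment k μ d

instance : Finite (Col k d μ) :=
  Finite.of_injective
    (fun c : Col k d μ => ((⟨c.1.1, c.2.1⟩ : {P : Path d // IsSegment k μ P}), c.1.2))
    (fun a b h => by
      simp only [Prod.mk.injEq, Subtype.mk.injEq] at h
      exact Subtype.ext (Prod.ext h.1 h.2))

lemma Symb.IsData.exists_isSegment {s : Symb d} (h : s.IsData k μ) :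
    ∃ P : {P : Path d // IsSegment k μ P}, ∃ x X, s = .v P x X ∨ s = .w P x X := by
  cases s with
  | v P x X => exact ⟨⟨P, h.1⟩, x, X, Or.inl rfl⟩
  | w P x X => exact ⟨⟨P, h.1⟩, x, X, Or.inr rfl⟩

instance : Finite {s : Symb d // s.IsData k μ} := by
  have : {s : Symb d | s.IsData k μ} ⊆
      Set.range (fun t : {P : Path d // IsSegment k μ P} × Fin d × Finset (Fin d) =>
        Symb.v t.1 t.2.1 t.2.2) ∪
      Set.range (fun t : {P : Path d // IsSegment k μ P} × Fin d × Finset (Fin d) =>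
        Symb.w t.1 t.2.1 t.2.2) := by
    intro s hs
    obtain ⟨P, x, X, rfl | rfl⟩ := Symb.IsData.exists_isSegment hs
    · exact Or.inl ⟨(P, x, X), rfl⟩
    · exact Or.inr ⟨(P, x, X), rfl⟩
  exact ((Set.finite_range _).union (Set.finite_range _)).subset this

/-- The symbol at position `(x, I)` of a segment. -/
def symbAt (P : Path d) (x : Fin d) (I : Finset (Fin d)) : Symb d :=
  if x ∈ I then .v P x I else .w P x (insert x I)

lemma symbAt_injective {P Q : Path d} {x y : Fin d} {I J : Finset (Fin d)}
    (h : symbAt P x I = symbAt Q y J) : P = Q ∧ x = y ∧ I = J := by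
  unfold symbAt at h
  split_ifs at h with h1 h2
  · simpa using h
  · rename_i h2
    obtain ⟨rfl, rfl, h⟩ := Symb.w.inj h
    refine ⟨rfl, rfl, ?_⟩
    rw [← Finset.erase_insert h1, h, Finset.erase_insert h2]

lemma symbAt_isData {P : Path d} {x : Fin d} {I : Finset (Fin d)} (hP : IsSegment k μ P)
    (hI : I.card = mode μ P) (h : ∃ j ∈ I, x ≤ j) (hn : ¬ IsNull k x I) :
    (symbAt P x I).IsData k μ := by
  unfold symbAt
  split_ifs with hx
  · exact ⟨hP, hI, hx, hn⟩
  · obtain ⟨j, hj, hxj⟩ := h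
    refine ⟨hP, ?_, Finset.mem_insert_self _ _, ⟨j, Finset.mem_insert_of_mem hj, ?_⟩, ?_⟩
    · rw [Finset.card_insert_of_notMem hx, hI]
    · exact lt_of_le_of_ne hxj (by rintro rfl; exact hx hj)
    · rwa [Finset.erase_insert hx]

open Classical in
/-- The data symbol that belongs to a top position: the symbol at that position, or the injected
symbol where the former is a parity. -/
noncomputable def ownSymb (P : Path d) (y : Fin d) (I : Finset (Fin d)) : Symb d :=
  if ∃ j ∈ I, y ≤ j then symbAt P y I else
    match P with
    | [] => symbAt [] y I
    | (x, B) :: Q => symbAt Q x (insert y (I ∪ B))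

lemma card_le_of_forall_lt {y : Fin d} {I : Finset (Fin d)} (h : ∀ j ∈ I, j < y) :
    I.card ≤ y := by
  have : I ⊆ Finset.Iio y := fun j hj => Finset.mem_Iio.mpr (h j hj)
  simpa using Finset.card_le_card this

lemma ownSymb_isData {P : Path d} {y : Fin d} {I : Finset (Fin d)} (hP : IsSegment k k P)
    (hI : I.card = mode k P) (hy : (y : ℕ) < k) : (ownSymb P y I).IsData k k := by
  unfold ownSymb
  split_ifs with h
  · exact symbAt_isData hP hI h fun hn => absurd hn.1 (not_le.mpr hy)
  · push Not at h
    cases P with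
    | nil =>
      -- The root has no parity in a top row: its columns have `k` elements, too many to lie below a
      -- row `y < k`.
      have := card_le_of_forall_lt h
      simp only [mode] at hI
      omega
    | cons p Q =>
      obtain ⟨x, B⟩ := p
      obtain ⟨hQ, hp, hB⟩ := hP
      change B.card < mode k Q at hB
      have hm : mode k ((x, B) :: Q) = mode k Q - B.card - 1 := rfl
      have hge : ∀ b ∈ B, k ≤ (b : ℕ) := hp.lower_set
      have hd : Disjoint I B := Finset.disjoint_left.mpr fun a ha hb => by
        have h1 : (a : ℕ) < y := h a ha
        have h2 := hge a hb
        omega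
      have hyB : y ∉ I ∪ B := by
        intro hyy
        rcases Finset.mem_union.mp hyy with hyy | hyy
        · exact lt_irrefl _ (h y hyy)
        · exact absurd (hge y hyy) (not_le.mpr hy)
      obtain ⟨b, hb, hxb⟩ := hp.le_max
      refine symbAt_isData hQ ?_ ⟨b, by simp [show b ∈ B from hb], hxb⟩ ?_
      · rw [Finset.card_insert_of_notMem hyB, Finset.card_union_of_disjoint hd]
        omega
      · intro hn
        exact absurd (hn.2.2 y (Finset.mem_insert_self _ _)) (not_le.mpr hy)

/-- The index of an injected symbol splits by size into `B` and `insert y I`, so the target position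
of the injection can be read off from its source. -/
lemma filter_insert_union {y : Fin d} {I B : Finset (Fin d)} (hy : (y : ℕ) < k)
    (hI : ∀ j ∈ I, j < y) (hB : ∀ b ∈ B, k ≤ (b : ℕ)) :
    (insert y (I ∪ B)).filter (fun a : Fin d => k ≤ (a : ℕ)) = B ∧
      (insert y (I ∪ B)).filter (fun a : Fin d => ¬ k ≤ (a : ℕ)) = insert y I := by
  have hI' : ∀ j ∈ I, (j : ℕ) < k := fun j hj => lt_trans (hI j hj) hy
  constructor
  · ext a
    simp only [mem_filter, mem_insert, mem_union]
    constructor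
    · rintro ⟨rfl | h | h, h'⟩
      · omega
      · have := hI' a h; omega
      · exact h
    · exact fun h => ⟨Or.inr (Or.inr h), hB a h⟩
  · ext a
    simp only [mem_filter, mem_insert, mem_union]
    constructor
    · rintro ⟨rfl | h | h, h'⟩
      · exact Or.inl rfl
      · exact Or.inr h
      · exact absurd (hB a h) h'
    · rintro (rfl | h)
      · exact ⟨Or.inl rfl, not_le.mpr hy⟩
      · exact ⟨Or.inr (Or.inl h), not_le.mpr (hI' a h)⟩

lemma insert_eq_insert_of_lt {y z : Fin d} {I J : Finset (Fin d)} (hI : ∀ j ∈ I, j < y)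
    (hJ : ∀ j ∈ J, j < z) (h : insert y I = insert z J) : y = z ∧ I = J := by
  have hyz : y = z := by
    apply le_antisymm
    · have : y ∈ insert z J := h ▸ Finset.mem_insert_self y I
      rcases Finset.mem_insert.mp this with h' | h'
      · exact h'.le
      · exact (hJ y h').le
    · have : z ∈ insert y I := h ▸ Finset.mem_insert_self z J
      rcases Finset.mem_insert.mp this with h' | h'
      · exact h'.le
      · exact (hI z h').le
  subst hyz
  refine ⟨rfl, ?_⟩
  rw [← Finset.erase_insert (fun h' => lt_irrefl _ (hI y h')), h,
    Finset.erase_insert (fun h' => lt_irrefl _ (hJ y h'))]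

/-- A symbol at its own top position has row below `k`, an injected one has row at least `k`, so the
two kinds never collide; two injected ones are separated by recovering `B`, `y` and `I`. -/
lemma ownSymb_injective {P Q : Path d} {y z : Fin d} {I J : Finset (Fin d)}
    (hP : IsSegment k k P) (hQ : IsSegment k k Q) (hI : I.card = mode k P)
    (hJ : J.card = mode k Q) (hy : (y : ℕ) < k) (hz : (z : ℕ) < k)
    (h : ownSymb P y I = ownSymb Q z J) : P = Q ∧ y = z ∧ I = J := by
  unfold ownSymb at h
  split_ifs at h with h1 h2 h2
  · exact symbAt_injective h
  · push Not at h2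
    cases Q with
    | nil =>
      have := card_le_of_forall_lt h2
      simp only [mode] at hJ
      omega
    | cons p Q =>
      have := (symbAt_injective h).2.1
      have h3 := hQ.2.1.lower_row
      rw [← this] at h3
      omega
  · push Not at h1
    cases P with
    | nil =>
      have := card_le_of_forall_lt h1
      simp only [mode] at hI
      omega
    | cons p P =>
      have := (symbAt_injective h).2.1
      have h3 := hP.2.1.lower_row
      rw [this] at h3
      omega
  · push Not at h1 h2
    cases P with
    | nil =>
      have := card_le_of_forall_lt h1
      simp only [mode] at hI
      omega
    | cons p P =>
      cases Q with
      | nil =>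
        have := card_le_of_forall_lt h2
        simp only [mode] at hJ
        omega
      | cons q Q =>
        obtain ⟨x, B⟩ := p
        obtain ⟨x', B'⟩ := q
        obtain ⟨rfl, rfl, h3⟩ := symbAt_injective h
        obtain ⟨e1, e2⟩ := filter_insert_union hy h1 hP.2.1.lower_set
        obtain ⟨e3, e4⟩ := filter_insert_union hz h2 hQ.2.1.lower_set
        rw [h3] at e1 e2
        obtain ⟨rfl, rfl⟩ := insert_eq_insert_of_lt h1 h2 (e2.symm.trans e4)
        have : B = B' := e1.symm.trans e3
        subst this
        exact ⟨rfl, rfl, rfl⟩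

/-- There are at least as many data symbols as entries in the first `k` rows. -/
lemma card_top_le (k d : ℕ) : Nat.card ({j : Fin d // (j : ℕ) < k} × Col k d k) ≤
    Nat.card {s : Symb d // s.IsData k k} := by
  refine Nat.card_le_card_of_injective
    (fun p => ⟨ownSymb p.2.1.1 p.1 p.2.1.2, ownSymb_isData p.2.2.1 p.2.2.2 p.1.2⟩) ?_
  rintro ⟨y, c⟩ ⟨z, c'⟩ h
  obtain ⟨h1, h2, h3⟩ := ownSymb_injective c.2.1 c'.2.1 c.2.2 c'.2.2 y.2 z.2
    (congrArg Subtype.val h)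
  exact Prod.ext (Subtype.ext h2) (Subtype.ext (Prod.ext h1 h3))

lemma finrank_file (k μ d : ℕ) :
    Module.finrank F (File F k d μ) = Nat.card {s : Symb d // s.IsData k μ} := by
  have := Fintype.ofFinite {s : Symb d // s.IsData k μ}
  rw [Module.finrank_fintype_fun_eq_card, Nat.card_eq_fintype_card]

end Counting

/-! ### Decoding from `k` nodes -/

section Contents

variable {F : Type*} [Field F] {k μ n d : ℕ} (Ψ : Matrix (Fin n) (Fin d) F)

/-- The part of an encoder row in the first `k` columns. -/
def topRow (k : ℕ) (h : Fin n) : {j : Fin d // (j : ℕ) < k} → F := fun j => Ψ h j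

/-- The first `k` entries of a column of the message matrix of a data file. -/
noncomputable def topEntries (v : File F k d μ) (c : Col k d μ) : {j : Fin d // (j : ℕ) < k} → F :=
  fun y => entry F k μ c.1.1 y c.1.2 v

lemma eq_zero_of_topEntries {v : File F k d μ} (h : ∀ c, topEntries v c = 0) : v = 0 :=
  file_eq_zero v fun P I y hP hI hy => congrFun (h ⟨(P, I), hP, hI⟩) ⟨y, hy⟩

/-- Where all columns of lower rank vanish at the top, the content of a node is the product of the
top parts. -/
lemma content_eq_of_lower_eq_zero (h : Fin n) (c : Col k d μ) (v : File F k d μ)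
    (hv : ∀ c' : Col k d μ, colRank μ c'.1.1 c'.1.2 < colRank μ c.1.1 c.1.2 →
      topEntries v c' = 0) :
    content k μ Ψ h c v = topRow Ψ k h ⬝ᵥ topEntries v c := by
  have hle : lower F k μ d (colRank μ c.1.1 c.1.2) ≤
      LinearMap.ker (Module.Dual.eval F (File F k d μ) v) := by
    refine Submodule.span_le.mpr ?_
    rintro φ ⟨P, I, y, h1, h2, h3, h4, rfl⟩
    exact congrFun (hv ⟨(P, I), h1, h2⟩ h4) ⟨y, h3⟩
  have hb : ∀ x : Fin d, ¬ (x : ℕ) < k → entry F k μ c.1.1 x c.1.2 v = 0 := fun x hx =>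
    hle (entry_bottom_mem c.2.1 c.2.2 (not_lt.mp hx))
  have hs : ∑ y : {j : Fin d // (j : ℕ) < k}, Ψ h y * entry F k μ c.1.1 y c.1.2 v =
      ∑ x ∈ Finset.univ.filter (fun j : Fin d => (j : ℕ) < k),
        Ψ h x * entry F k μ c.1.1 x c.1.2 v :=
    (Finset.sum_subtype _ (by simp) (fun x => Ψ h x * entry F k μ c.1.1 x c.1.2 v)).symm
  have hl : content k μ Ψ h c v = ∑ x : Fin d, Ψ h x * entry F k μ c.1.1 x c.1.2 v := by
    simp [content, segContent, LinearMap.sum_apply]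
  rw [hl]
  refine Eq.trans ?_ hs.symm
  refine (Finset.sum_subset (Finset.subset_univ _) fun x _ hx => ?_).symm
  rw [hb x (by simpa using hx), mul_zero]

variable {Ψ}

lemma card_lt_subtype (hkd : k ≤ d) : Fintype.card {j : Fin d // (j : ℕ) < k} = k := by
  rw [Fintype.card_subtype]
  have : (Finset.univ.filter fun j : Fin d => (j : ℕ) < k) =
      Finset.map (Fin.castLEEmb hkd) Finset.univ := by
    ext j
    simp only [mem_filter, mem_univ, true_and, mem_map]
    exact ⟨fun h => ⟨⟨j, h⟩, Fin.ext rfl⟩, by rintro ⟨i, rfl⟩; exact i.2⟩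
  rw [this]
  simp

lemma IsEncoder.eq_zero_of_topRow (hΨ : IsEncoder k Ψ) (hkd : k ≤ d) {e : Fin k → Fin n}
    (he : Function.Injective e) {x : {j : Fin d // (j : ℕ) < k} → F}
    (hx : ∀ i, topRow Ψ k (e i) ⬝ᵥ x = 0) : x = 0 :=
  eq_zero_of_dotProduct_eq_zero (hΨ.top e he) (by rw [card_lt_subtype hkd, Fintype.card_fin]) hx

/-- The contents of `k` nodes as a linear map. -/
noncomputable def contentMap (k μ : ℕ) (Ψ : Matrix (Fin n) (Fin d) F) (e : Fin k → Fin n) :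
    File F k d μ →ₗ[F] (Fin k × Col k d μ → F) :=
  LinearMap.pi fun p => content k μ Ψ (e p.1) p.2

/-- Where the contents of `k` nodes vanish up to some column, so does the top of the message
matrix. -/
lemma topEntries_eq_of_content (hΨ : IsEncoder k Ψ) (hkd : k ≤ d) {e : Fin k → Fin n}
    (he : Function.Injective e) (v : File F k d μ) (r : ℕ)
    (hv : ∀ c : Col k d μ, colRank μ c.1.1 c.1.2 < r → ∀ i, content k μ Ψ (e i) c v = 0) :
    ∀ c : Col k d μ, colRank μ c.1.1 c.1.2 < r → topEntries v c = 0 := by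
  have key : ∀ s ≤ r, ∀ c : Col k d μ, colRank μ c.1.1 c.1.2 < s → topEntries v c = 0 := by
    intro s
    induction s with
    | zero => intro _ c hc; omega
    | succ s ih =>
      intro hs c hc
      refine hΨ.eq_zero_of_topRow hkd he fun i => ?_
      rw [← content_eq_of_lower_eq_zero Ψ (e i) c v]
      · exact hv c (by omega) i
      · exact fun c' hc' => ih (by omega) c' (by omega)
  exact key r le_rfl

lemma contentMap_injective (hΨ : IsEncoder k Ψ) (hkd : k ≤ d) {e : Fin k → Fin n}
    (he : Function.Injective e) : Function.Injective (contentMap k μ Ψ e) := by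
  rw [injective_iff_map_eq_zero]
  intro v hv
  refine eq_zero_of_topEntries fun c => ?_
  exact topEntries_eq_of_content hΨ hkd he v _ (fun c' _ i => congrFun hv (i, c')) c
    (Nat.lt_succ_self _)

/-- Any `k` nodes have independent contents. -/
lemma contentMap_surjective (hΨ : IsEncoder k Ψ) (hkd : k ≤ d) {e : Fin k → Fin n}
    (he : Function.Injective e) : Function.Surjective (contentMap k k Ψ e) := by
  have := Fintype.ofFinite (Col k d k)
  have h1 := contentMap_injective (μ := k) hΨ hkd he
  have h2 := LinearMap.finrank_le_finrank_of_injective h1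
  -- Injectivity bounds the number of data symbols by `k` times the number of columns; the count
  -- gives the reverse inequality.
  have h3 := card_top_le k d
  rw [Nat.card_prod, Nat.card_eq_fintype_card (α := {j : Fin d // (j : ℕ) < k}),
    card_lt_subtype hkd] at h3
  refine (LinearMap.injective_iff_surjective_of_finrank_eq_finrank (le_antisymm h2 ?_)).mp h1
  rw [finrank_file, Module.finrank_fintype_fun_eq_card, Fintype.card_prod, Fintype.card_fin,
    ← Nat.card_eq_fintype_card]
  exact h3

end Contents

end CascadeCode

namespace CascadeCode

open Finset

/-! ### Exterior algebra in coordinates -/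

section Exterior

variable {F : Type*} [Field F] {d : ℕ}

/-- Creation operators on functions of index sets. -/
def create (F : Type*) [Field F] {d : ℕ} (y : Fin d) :
    (Finset (Fin d) → F) →ₗ[F] (Finset (Fin d) → F) where
  toFun v I := if y ∈ I then (-1) ^ ind I y * v (I.erase y) else 0
  map_add' v w := by
    funext I
    by_cases h : y ∈ I <;> simp [h, mul_add]
  map_smul' c v := by
    funext I
    by_cases h : y ∈ I <;> simp [h, mul_left_comm]

/-- Annihilation operators on functions of index sets. -/
def annihilate (F : Type*) [Field F] {d : ℕ} (y : Fin d) :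
    (Finset (Fin d) → F) →ₗ[F] (Finset (Fin d) → F) where
  toFun v I := if y ∈ I then 0 else (-1) ^ ind (insert y I) y * v (insert y I)
  map_add' v w := by
    funext I
    by_cases h : y ∈ I <;> simp [h, mul_add]
  map_smul' c v := by
    funext I
    by_cases h : y ∈ I <;> simp [h, mul_left_comm]

lemma ind_erase_of_le {I : Finset (Fin d)} {y z : Fin d} (hy : y ∈ I) (h : y ≤ z) :
    ind I z = ind (I.erase y) z + 1 := by
  unfold ind
  rw [Finset.filter_erase, Finset.card_erase_add_one (by simp [hy, h])]

lemma ind_erase_of_lt {I : Finset (Fin d)} {y z : Fin d} (h : z < y) :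
    ind (I.erase y) z = ind I z := by
  unfold ind
  rw [Finset.filter_erase, Finset.erase_eq_of_notMem (by simp [h])]

lemma create_create_self (y : Fin d) (v : Finset (Fin d) → F) :
    create F y (create F y v) = 0 := by
  funext I
  simp [create]

lemma create_create (y z : Fin d) (v : Finset (Fin d) → F) :
    create F y (create F z v) + create F z (create F y v) = 0 := by
  rcases eq_or_ne y z with rfl | hne
  · simp [create_create_self]
  wlog hlt : y < z generalizing y z
  · rw [add_comm]
    exact this z y hne.symm (lt_of_le_of_ne (not_lt.mp hlt) hne.symm)
  funext I
  by_cases hy : y ∈ I <;> by_cases hz : z ∈ I <;>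
    simp [create, hy, hz, hne, hne.symm]
  rw [ind_erase_of_lt hlt, ind_erase_of_le hy hlt.le, Finset.erase_right_comm, pow_succ]
  ring

lemma annihilate_create_self (y : Fin d) (v : Finset (Fin d) → F) :
    annihilate F y (create F y v) + create F y (annihilate F y v) = v := by
  funext I
  by_cases hy : y ∈ I
  · simp [create, annihilate, hy, ← mul_assoc, ← pow_add, ← two_mul]
  · simp [create, annihilate, hy, ← mul_assoc, ← pow_add, ← two_mul]

lemma annihilate_create {y z : Fin d} (hne : y ≠ z) (v : Finset (Fin d) → F) :
    annihilate F y (create F z v) + create F z (annihilate F y v) = 0 := by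
  funext I
  by_cases hy : y ∈ I <;> by_cases hz : z ∈ I <;>
    simp [create, annihilate, hy, hz, hne, hne.symm]
  rw [Finset.erase_insert_of_ne hne]
  rcases lt_or_gt_of_ne hne with hlt | hlt
  · rw [ind_erase_of_le (z := z) (Finset.mem_insert_self y I) hlt.le, Finset.erase_insert hy,
      ← Finset.erase_insert_of_ne hne, ind_erase_of_lt hlt, pow_succ]
    ring
  · rw [ind_erase_of_le (z := y) (Finset.mem_insert_of_mem hz) hlt.le,
      Finset.erase_insert_of_ne hne, ← ind_erase_of_lt (I := insert y I) hlt,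
      Finset.erase_insert hy, pow_succ]
    ring

/-- Exterior multiplication by a vector. -/
def wedge (a : Fin d → F) : (Finset (Fin d) → F) →ₗ[F] (Finset (Fin d) → F) :=
  ∑ y, a y • create F y

/-- Contraction by a covector. -/
def contract (a : Fin d → F) : (Finset (Fin d) → F) →ₗ[F] (Finset (Fin d) → F) :=
  ∑ y, a y • annihilate F y

lemma wedge_apply (a : Fin d → F) (v : Finset (Fin d) → F) :
    wedge a v = ∑ y, a y • create F y v := by
  simp [wedge, LinearMap.sum_apply]

lemma contract_apply (a : Fin d → F) (v : Finset (Fin d) → F) :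
    contract a v = ∑ y, a y • annihilate F y v := by
  simp [contract, LinearMap.sum_apply]

lemma wedge_wedge_eq_sum (a b : Fin d → F) (v : Finset (Fin d) → F) :
    wedge a (wedge b v) = ∑ p : Fin d × Fin d, (a p.1 * b p.2) • create F p.1 (create F p.2 v) := by
  rw [Fintype.sum_prod_type, wedge_apply]
  refine Finset.sum_congr rfl fun y _ => ?_
  rw [wedge_apply, map_sum, Finset.smul_sum]
  exact Finset.sum_congr rfl fun z _ => by rw [map_smul, smul_smul]

lemma wedge_wedge_self (a : Fin d → F) (v : Finset (Fin d) → F) : wedge a (wedge a v) = 0 := by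
  rw [wedge_wedge_eq_sum]
  -- Off-diagonal terms cancel in pairs. Diagonal terms vanish individually, so characteristic two
  -- needs no special care.
  refine Finset.sum_involution (fun p _ => p.swap) ?_ ?_ (fun _ _ => Finset.mem_univ _)
    (fun p _ => Prod.swap_swap p)
  · rintro ⟨y, z⟩ -
    rw [Prod.fst_swap, Prod.snd_swap, mul_comm (a _), ← smul_add, create_create, smul_zero]
  · rintro ⟨y, z⟩ - h h'
    obtain rfl : z = y := congrArg Prod.fst h'
    exact h (by rw [create_create_self, smul_zero])

lemma wedge_wedge (a b : Fin d → F) (v : Finset (Fin d) → F) :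
    wedge a (wedge b v) + wedge b (wedge a v) = 0 := by
  rw [wedge_wedge_eq_sum, wedge_wedge_eq_sum b a,
    ← (Equiv.prodComm (Fin d) (Fin d)).sum_comp (fun p => (b p.1 * a p.2) • _),
    ← Finset.sum_add_distrib]
  refine Finset.sum_eq_zero fun p _ => ?_
  simp only [Equiv.prodComm_apply, Prod.fst_swap, Prod.snd_swap]
  rw [mul_comm (b _), ← smul_add, create_create, smul_zero]

/-- The homotopy identity: when `a ⬝ᵥ b = 1`, contraction by `a` inverts multiplication by `b` on
its kernel. -/
lemma contract_wedge (a b : Fin d → F) (v : Finset (Fin d) → F) :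
    contract a (wedge b v) + wedge b (contract a v) = (a ⬝ᵥ b) • v := by
  have h1 : contract a (wedge b v) = ∑ y, ∑ z, (a y * b z) • annihilate F y (create F z v) := by
    rw [contract_apply]
    refine Finset.sum_congr rfl fun y _ => ?_
    rw [wedge_apply, map_sum, Finset.smul_sum]
    exact Finset.sum_congr rfl fun z _ => by rw [map_smul, smul_smul]
  have h2 : wedge b (contract a v) = ∑ y, ∑ z, (a y * b z) • create F z (annihilate F y v) := by
    rw [contract_apply, map_sum]
    refine Finset.sum_congr rfl fun y _ => ?_
    rw [map_smul, wedge_apply, Finset.smul_sum]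
    exact Finset.sum_congr rfl fun z _ => by rw [smul_smul]
  rw [h1, h2, ← Finset.sum_add_distrib, dotProduct, Finset.sum_smul]
  refine Finset.sum_congr rfl fun y _ => ?_
  rw [← Finset.sum_add_distrib, Finset.sum_eq_single y]
  · rw [← smul_add, annihilate_create_self]
  · intro z _ hz
    rw [← smul_add, annihilate_create hz.symm, smul_zero]
  · simp

/-- Functions supported on index sets of size `m`. -/
def homog (F : Type*) [Field F] (d m : ℕ) : Submodule F (Finset (Fin d) → F) where
  carrier := {v | ∀ I : Finset (Fin d), I.card ≠ m → v I = 0}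
  add_mem' := fun h1 h2 I hI => by simp [h1 I hI, h2 I hI]
  zero_mem' := fun _ _ => rfl
  smul_mem' := fun c v h I hI => by simp [h I hI]

lemma create_mem {m : ℕ} {v : Finset (Fin d) → F} (hv : v ∈ homog F d m) (y : Fin d) :
    create F y v ∈ homog F d (m + 1) := by
  intro I hI
  by_cases hy : y ∈ I
  · have : (I.erase y).card ≠ m := by
      have := Finset.card_erase_add_one hy
      omega
    simp [create, hy, hv _ this]
  · simp [create, hy]

lemma annihilate_mem {m : ℕ} {v : Finset (Fin d) → F} (hv : v ∈ homog F d (m + 1)) (y : Fin d) :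
    annihilate F y v ∈ homog F d m := by
  intro I hI
  by_cases hy : y ∈ I
  · simp [annihilate, hy]
  · have : (insert y I).card ≠ m + 1 := by
      rw [Finset.card_insert_of_notMem hy]
      omega
    simp [annihilate, hy, hv _ this]

lemma wedge_mem {m : ℕ} {v : Finset (Fin d) → F} (hv : v ∈ homog F d m) (a : Fin d → F) :
    wedge a v ∈ homog F d (m + 1) := by
  rw [wedge_apply]
  exact Submodule.sum_mem _ fun y _ => Submodule.smul_mem _ _ (create_mem hv y)

lemma contract_mem {m : ℕ} {v : Finset (Fin d) → F} (hv : v ∈ homog F d (m + 1)) (a : Fin d → F) :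
    contract a v ∈ homog F d m := by
  rw [contract_apply]
  exact Submodule.sum_mem _ fun y _ => Submodule.smul_mem _ _ (annihilate_mem hv y)

lemma contract_eq_zero {v : Finset (Fin d) → F} (hv : v ∈ homog F d 0) (a : Fin d → F) :
    contract a v = 0 := by
  rw [contract_apply]
  refine Finset.sum_eq_zero fun y _ => ?_
  have : annihilate F y v = 0 := by
    funext I
    simp [annihilate, hv (insert y I) (by simp)]
  rw [this, smul_zero]

lemma finrank_homog (d m : ℕ) : Module.finrank F (homog F d m) = d.choose m := by
  have e : homog F d m ≃ₗ[F] ({I : Finset (Fin d) // I.card = m} → F) :=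
    { toFun := fun v I => v.1 I.1
      map_add' := fun _ _ => rfl
      map_smul' := fun _ _ => rfl
      invFun := fun w => ⟨fun I => if h : I.card = m then w ⟨I, h⟩ else 0, fun I hI => dif_neg hI⟩
      left_inv := fun v => by
        ext I
        by_cases h : I.card = m
        · simp [h]
        · simp [h, v.2 I h]
      right_inv := fun w => by
        funext I
        simp [I.2] }
  rw [e.finrank_eq, Module.finrank_fintype_fun_eq_card, Fintype.card_finset_len, Fintype.card_fin]

lemma finrank_map_add_finrank_inf_ker {V W : Type*} [AddCommGroup V] [Module F V]
    [FiniteDimensional F V] [AddCommGroup W] [Module F W] (f : V →ₗ[F] W) (S : Submodule F V) :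
    Module.finrank F (S.map f) + Module.finrank F (S ⊓ LinearMap.ker f : Submodule F V) =
      Module.finrank F S := by
  rw [← (f.domRestrict S).finrank_range_add_finrank_ker, LinearMap.range_domRestrict]
  congr 1
  rw [(Submodule.equivMapOfInjective S.subtype S.injective_subtype
    (LinearMap.ker (f.domRestrict S))).finrank_eq, LinearMap.ker_domRestrict,
    Submodule.map_comap_subtype]

lemma map_wedge_homog {a α : Fin d → F} (hα : α ⬝ᵥ a = 1) (m : ℕ) :
    (homog F d m).map (wedge a) = homog F d (m + 1) ⊓ LinearMap.ker (wedge a) := by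
  ext x
  constructor
  · rintro ⟨v, hv, rfl⟩
    exact ⟨wedge_mem hv a, wedge_wedge_self a v⟩
  · rintro ⟨hx, hx'⟩
    refine ⟨contract α x, contract_mem hx α, ?_⟩
    have := contract_wedge α a x
    rwa [show wedge a x = 0 from hx', map_zero, zero_add, hα, one_smul] at this

lemma homog_zero_inf_ker {a α : Fin d → F} (hα : α ⬝ᵥ a = 1) :
    homog F d 0 ⊓ LinearMap.ker (wedge a) = ⊥ := by
  refine (Submodule.eq_bot_iff _).mpr ?_
  rintro x ⟨hx, hx'⟩
  have := contract_wedge α a x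
  rw [show wedge a x = 0 from hx', map_zero, zero_add, hα, one_smul, contract_eq_zero hx,
    map_zero] at this
  exact this.symm

/-- Exactness makes the kernel in each degree the image of the previous one; rank-nullity then runs
Pascal's rule. -/
lemma finrank_homog_inf_ker {N : ℕ} {a α : Fin (N + 1) → F} (hα : α ⬝ᵥ a = 1) (m : ℕ) :
    Module.finrank F (homog F (N + 1) (m + 1) ⊓ LinearMap.ker (wedge a) :
      Submodule F (Finset (Fin (N + 1)) → F)) = N.choose m := by
  induction m with
  | zero =>
    have := finrank_map_add_finrank_inf_ker (wedge a) (homog F (N + 1) 0)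
    rw [map_wedge_homog hα, homog_zero_inf_ker hα, finrank_bot, finrank_homog] at this
    simpa using this
  | succ m ih =>
    have := finrank_map_add_finrank_inf_ker (wedge a) (homog F (N + 1) (m + 1))
    rw [map_wedge_homog hα, ih, finrank_homog, Nat.choose_succ_succ'] at this
    omega

/-- Since `β ⬝ᵥ a = 0`, contraction by `β` anticommutes with `wedge a` and preserves its kernel, so
multiplication by `b` stays exact there. -/
lemma map_wedge_homog_inf_ker {a b β : Fin d → F} (hb : β ⬝ᵥ b = 1) (ha : β ⬝ᵥ a = 0) (m : ℕ) :
    (homog F d m ⊓ LinearMap.ker (wedge a)).map (wedge b) =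
      (homog F d (m + 1) ⊓ LinearMap.ker (wedge a)) ⊓ LinearMap.ker (wedge b) := by
  ext x
  constructor
  · rintro ⟨v, ⟨hv, hv'⟩, rfl⟩
    refine ⟨⟨wedge_mem hv b, ?_⟩, wedge_wedge_self b v⟩
    have := wedge_wedge a b v
    rwa [show wedge a v = 0 from hv', map_zero, add_zero] at this
  · rintro ⟨⟨hx, hx'⟩, hx''⟩
    refine ⟨contract β x, ⟨contract_mem hx β, ?_⟩, ?_⟩
    · have := contract_wedge β a x
      rwa [show wedge a x = 0 from hx', map_zero, zero_add, ha, zero_smul] at this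
    · have := contract_wedge β b x
      rwa [show wedge b x = 0 from hx'', map_zero, zero_add, hb, one_smul] at this

/-- The dimension of the multiples of `a ∧ b` of degree `m` in dimension `d`. -/
def doubleDim (d m : ℕ) : ℕ := if 2 ≤ m then (d - 2).choose (m - 2) else 0

lemma finrank_homog_inf_ker_inf_ker {N : ℕ} {a b α β : Fin (N + 2) → F} (hα : α ⬝ᵥ a = 1)
    (hb : β ⬝ᵥ b = 1) (ha : β ⬝ᵥ a = 0) (m : ℕ) :
    Module.finrank F ((homog F (N + 2) m ⊓ LinearMap.ker (wedge a)) ⊓ LinearMap.ker (wedge b) :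
      Submodule F (Finset (Fin (N + 2)) → F)) = doubleDim (N + 2) m := by
  have h0 : (homog F (N + 2) 0 ⊓ LinearMap.ker (wedge a)) ⊓ LinearMap.ker (wedge b) = ⊥ := by
    rw [homog_zero_inf_ker hα, bot_inf_eq]
  have h1 : (homog F (N + 2) 1 ⊓ LinearMap.ker (wedge a)) ⊓ LinearMap.ker (wedge b) = ⊥ := by
    rw [← map_wedge_homog_inf_ker hb ha, homog_zero_inf_ker hα, Submodule.map_bot]
  induction m with
  | zero => rw [h0, finrank_bot]; rfl
  | succ m ih =>
    match m with
    | 0 => rw [h1, finrank_bot]; rfl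
    | 1 =>
      have := finrank_map_add_finrank_inf_ker (wedge b)
        (homog F (N + 2) 1 ⊓ LinearMap.ker (wedge a))
      rw [map_wedge_homog_inf_ker hb ha, h1, finrank_bot, finrank_homog_inf_ker hα] at this
      simpa [doubleDim] using this
    | m + 2 =>
      have := finrank_map_add_finrank_inf_ker (wedge b)
        (homog F (N + 2) (m + 2) ⊓ LinearMap.ker (wedge a))
      rw [map_wedge_homog_inf_ker hb ha, ih, finrank_homog_inf_ker hα, Nat.choose_succ_succ'] at this
      have e1 : doubleDim (N + 2) (m + 2) = N.choose m := by simp [doubleDim]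
      have e2 : doubleDim (N + 2) (m + 2 + 1) = N.choose (m + 1) := by
        simp [doubleDim, show m + 2 + 1 - 2 = m + 1 by omega]
      omega

end Exterior

end CascadeCode

namespace CascadeCode

open Finset

/-! ### Summation over the injection tree -/

section SegmentCount

variable {k μ d : ℕ}

open Classical in
/-- The injection pairs `(x, B)` with `|B| = b`. -/
noncomputable def pairs (k d b : ℕ) : Finset (Fin d × Finset (Fin d)) :=
  Finset.univ.filter fun p => IsInjectionPair k p.1 p.2 ∧ p.2.card = b

lemma card_le_subtype (k d : ℕ) :
    (Finset.univ.filter fun x : Fin d => k ≤ (x : ℕ)).card = d - k := by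
  rw [← Finset.card_map Fin.valEmbedding, ← Nat.card_Ico]
  congr 1
  ext x
  simp only [mem_map, mem_filter, mem_univ, true_and, mem_Ico, Fin.valEmbedding_apply]
  exact ⟨by rintro ⟨y, hy, rfl⟩; exact ⟨hy, y.2⟩, fun h => ⟨⟨x, h.2⟩, h.1, rfl⟩⟩

/-- Among all `(x, B)` in the bottom rows, those violating `x ≤ max B` are the `(b + 1)`-sets with
their maximum singled out. -/
lemma card_pairs (k d b : ℕ) :
    (pairs k d b).card + (d - k).choose (b + 1) = (d - k) * (d - k).choose b := by
  classical
  set U := Finset.univ.filter fun x : Fin d => k ≤ (x : ℕ) with hU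
  have hUc : U.card = d - k := card_le_subtype k d
  have h1 : (U ×ˢ U.powersetCard b).card = (d - k) * (d - k).choose b := by
    rw [Finset.card_product, Finset.card_powersetCard, hUc]
  rw [← h1, ← Finset.card_filter_add_card_filter_not (s := U ×ˢ U.powersetCard b)
    (fun p => ∃ y ∈ p.2, p.1 ≤ y)]
  congr 1
  · congr 1
    ext ⟨x, B⟩
    simp only [pairs, mem_filter, mem_univ, true_and, mem_product, mem_powersetCard, hU,
      Finset.subset_iff]
    constructor
    · rintro ⟨⟨h2, h3, h4⟩, h5⟩
      exact ⟨⟨h3, h2, h5⟩, h4⟩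
    · rintro ⟨⟨h3, h2, h5⟩, h4⟩
      exact ⟨⟨fun b hb => h2 hb, h3, h4⟩, h5⟩
  · rw [← hUc, ← Finset.card_powersetCard]
    symm
    refine Finset.card_bij (fun p _ => insert p.1 p.2) ?_ ?_ ?_
    · rintro ⟨x, B⟩ h
      simp only [mem_filter, mem_product, mem_powersetCard, not_exists, not_and, not_le] at h
      obtain ⟨⟨hx, hB, hc⟩, hlt⟩ := h
      rw [mem_powersetCard, Finset.card_insert_of_notMem fun h => lt_irrefl _ (hlt x h)]
      exact ⟨Finset.insert_subset hx hB, by omega⟩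
    · rintro ⟨x, B⟩ h ⟨x', B'⟩ h' heq
      simp only [mem_filter, not_exists, not_and, not_le] at h h'
      obtain ⟨h1, h2⟩ := insert_eq_insert_of_lt h.2 h'.2 heq
      exact Prod.ext h1 h2
    · intro Y hY
      obtain ⟨hYU, hYc⟩ := mem_powersetCard.mp hY
      have hne : Y.Nonempty := Finset.card_pos.mp (by omega)
      refine ⟨(Y.max' hne, Y.erase (Y.max' hne)), ?_, Finset.insert_erase (Y.max'_mem hne)⟩
      simp only [mem_filter, mem_product, mem_powersetCard, not_exists, not_and, not_le]
      refine ⟨⟨hYU (Y.max'_mem hne), (Finset.erase_subset _ _).trans hYU, ?_⟩,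
        fun y hy => Y.lt_max'_of_mem_erase_max' hne hy⟩
      rw [Finset.card_erase_of_mem (Y.max'_mem hne), hYc]
      rfl

/-- The set of all code segments. -/
noncomputable def segments (k μ d : ℕ) : Finset (Path d) := (finite_isSegment k μ d).toFinset

lemma mem_segments {P : Path d} : P ∈ segments k μ d ↔ IsSegment k μ P :=
  (finite_isSegment k μ d).mem_toFinset

/-- Summing over all segments by their parents. -/
lemma sum_segments (k μ d : ℕ) (φ : ℕ → ℤ) :
    ∑ P ∈ segments k μ d, φ (mode μ P) = φ μ + ∑ P ∈ segments k μ d,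
      ∑ b ∈ Finset.range (mode μ P), ((pairs k d b).card : ℤ) * φ (mode μ P - b - 1) := by
  classical
  have hnil : [] ∈ segments k μ d := mem_segments.mpr trivial
  rw [← Finset.add_sum_erase _ _ hnil]
  congr 1
  have h1 : ∀ P ∈ segments k μ d, ∑ b ∈ Finset.range (mode μ P),
      ((pairs k d b).card : ℤ) * φ (mode μ P - b - 1) =
      ∑ p ∈ (Finset.range (mode μ P)).sigma (fun b => pairs k d b),
        φ (mode μ (p.2 :: P)) := by
    intro P _
    rw [Finset.sum_sigma]
    refine Finset.sum_congr rfl fun b _ => ?_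
    rw [← nsmul_eq_mul, ← Finset.sum_const]
    refine Finset.sum_congr rfl fun p hp => ?_
    rw [mode, (Finset.mem_filter.mp hp).2.2]
  rw [Finset.sum_congr rfl h1, Finset.sum_sigma']
  symm
  refine Finset.sum_bij (fun q _ => q.2.2 :: q.1) ?_ ?_ ?_ (fun _ _ => rfl)
  · rintro ⟨P, b, p⟩ h
    simp only [mem_sigma, mem_range, pairs, mem_filter, mem_univ, true_and] at h
    refine Finset.mem_erase.mpr ⟨by simp, mem_segments.mpr ⟨mem_segments.mp h.1, h.2.2.1, ?_⟩⟩
    rw [h.2.2.2]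
    exact h.2.1
  · rintro ⟨P, b, p⟩ h ⟨P', b', p'⟩ h' heq
    simp only [mem_sigma, mem_range, pairs, mem_filter, mem_univ, true_and] at h h'
    obtain ⟨rfl, rfl⟩ := List.cons.inj heq
    obtain rfl : b = b' := h.2.2.2.symm.trans h'.2.2.2
    rfl
  · intro Q hQ
    obtain ⟨hne, hQ⟩ := Finset.mem_erase.mp hQ
    cases Q with
    | nil => exact absurd rfl hne
    | cons p P =>
      obtain ⟨h1, h2, h3⟩ := mem_segments.mp hQ
      refine ⟨⟨P, p.2.card, p⟩, ?_, rfl⟩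
      simp only [mem_sigma, mem_range, pairs, mem_filter, mem_univ, true_and, and_true]
      exact ⟨mem_segments.mpr h1, h3, h2⟩

/-- The generating function of the binomial coefficients. -/
lemma mk_choose (t : ℕ) :
    PowerSeries.mk (fun m => (t.choose m : ℤ)) = (1 + PowerSeries.X) ^ t := by
  ext m
  have h : ((1 + PowerSeries.X : PowerSeries ℤ)) ^ t =
      (((1 + Polynomial.X : Polynomial ℤ) ^ t : Polynomial ℤ) : PowerSeries ℤ) := by simp
  rw [h, Polynomial.coeff_coe, Polynomial.coeff_one_add_X_pow, PowerSeries.coeff_mk]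

lemma mk_doubleDim (N : ℕ) :
    PowerSeries.mk (fun m => (doubleDim (N + 2) m : ℤ)) =
      PowerSeries.X ^ 2 * (1 + PowerSeries.X) ^ N := by
  ext m
  rw [← mk_choose, PowerSeries.coeff_X_pow_mul', PowerSeries.coeff_mk, doubleDim]
  split_ifs <;> simp

/-- The weighted sum of the dimensions `doubleDim k j` for `j ≤ m`. -/
def cascadeSum (k t m : ℕ) : ℤ := ∑ j ∈ Finset.range (m + 1), (t : ℤ) ^ (m - j) * doubleDim k j

lemma cascadeSum_succ (k t m : ℕ) :
    cascadeSum k t (m + 1) = t * cascadeSum k t m + doubleDim k (m + 1) := by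
  rw [cascadeSum, Finset.sum_range_succ, Nat.sub_self, pow_zero, one_mul, cascadeSum,
    Finset.mul_sum]
  congr 1
  refine Finset.sum_congr rfl fun j hj => ?_
  have : j ≤ m := Nat.lt_succ_iff.mp (Finset.mem_range.mp hj)
  rw [Nat.succ_sub this, pow_succ]
  ring

lemma mk_cascadeSum (N t : ℕ) :
    PowerSeries.mk (cascadeSum (N + 2) t) * (1 - (t : PowerSeries ℤ) * PowerSeries.X) =
      PowerSeries.X ^ 2 * (1 + PowerSeries.X) ^ N := by
  rw [← mk_doubleDim]
  ext m
  rw [mul_sub, mul_one, ← mul_assoc, ← map_natCast (PowerSeries.C (R := ℤ)),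
    mul_comm (PowerSeries.mk _) (PowerSeries.C _), mul_assoc]
  cases m with
  | zero =>
    simp [cascadeSum]
  | succ m =>
    rw [map_sub, PowerSeries.coeff_C_mul, PowerSeries.coeff_succ_mul_X]
    simp only [PowerSeries.coeff_mk]
    rw [cascadeSum_succ]
    simp

/-- The value at a root equals its own `doubleDim` plus the values at its children, which is what
lets the sum over the tree collapse. It is proved as an identity of power series. -/
lemma cascadeSum_eq (k d m : ℕ) (hk : 2 ≤ k) (hkd : k ≤ d) :
    cascadeSum k (d - k) m = doubleDim d m + ∑ b ∈ Finset.range m,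
      ((pairs k d b).card : ℤ) * cascadeSum k (d - k) (m - b - 1) := by
  obtain ⟨N, rfl⟩ := Nat.exists_eq_add_of_le' hk
  obtain ⟨t, rfl⟩ := Nat.exists_eq_add_of_le' hkd
  rw [Nat.add_sub_cancel]
  set c : PowerSeries ℤ := PowerSeries.mk fun
    | 0 => 0
    | b + 1 => ((pairs (N + 2) (t + (N + 2)) b).card : ℤ) with hc
  set Φ := PowerSeries.mk (cascadeSum (N + 2) t) with hΦ
  -- The exponents in `c` are the mode drops `b + 1`, so `card_pairs` gives `c = t X (1 + X)^t - ((1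
  -- + X)^t - 1)`.
  have h1 : 1 - c = (1 + PowerSeries.X) ^ t * (1 - (t : PowerSeries ℤ) * PowerSeries.X) := by
    have h : c = (t : PowerSeries ℤ) * (1 + PowerSeries.X) ^ t * PowerSeries.X -
        ((1 + PowerSeries.X) ^ t - 1) := by
      rw [← mk_choose, ← map_natCast (PowerSeries.C (R := ℤ)), mul_assoc]
      ext m
      cases m with
      | zero => simp [hc]
      | succ b =>
        rw [map_sub, map_sub, PowerSeries.coeff_C_mul, PowerSeries.coeff_succ_mul_X]
        simp only [hc, PowerSeries.coeff_mk, PowerSeries.coeff_one]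
        have := card_pairs (N + 2) (t + (N + 2)) b
        rw [Nat.add_sub_cancel] at this
        have h' : ((pairs (N + 2) (t + (N + 2)) b).card : ℤ) + (t.choose (b + 1) : ℤ) =
          (t : ℤ) * (t.choose b : ℤ) := by exact_mod_cast this
        simp only [Nat.add_eq_zero_iff, one_ne_zero, and_false, if_false]
        linarith
    rw [h]
    ring
  have h2 : Φ = PowerSeries.mk (fun m => (doubleDim (t + (N + 2)) m : ℤ)) + c * Φ := by
    rw [← add_assoc t N 2, mk_doubleDim, pow_add, mul_left_comm, ← mk_cascadeSum N t]
    linear_combination Φ * h1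
  have h3 := congrArg (PowerSeries.coeff m) h2
  rw [map_add, PowerSeries.coeff_mul, Finset.Nat.sum_antidiagonal_eq_sum_range_succ_mk,
    Finset.sum_range_succ'] at h3
  simp only [hΦ, hc, PowerSeries.coeff_mk, zero_mul, add_zero] at h3
  rw [h3]
  congr 1

/-- The sum of `doubleDim` over all code segments. -/
lemma sum_doubleDim (k μ d : ℕ) (hk : 2 ≤ k) (hkd : k ≤ d) :
    ∑ P ∈ segments k μ d, (doubleDim d (mode μ P) : ℤ) = cascadeSum k (d - k) μ := by
  -- Every segment but the root appears once as itself and once as a child; only the root value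
  -- remains.
  have h := sum_segments k μ d (cascadeSum k (d - k))
  rw [Finset.sum_congr rfl fun P _ => cascadeSum_eq k d (mode μ P) hk hkd,
    Finset.sum_add_distrib] at h
  linarith

end SegmentCount

end CascadeCode

/-! ### Matching the binomial expression -/

lemma binom_natCast (l m : ℕ) : binom l m = l.choose m := by
  unfold binom
  split_ifs with h
  · simp
  · rw [Nat.choose_eq_zero_of_lt (by omega)]
    rfl

lemma binom_combination (k m : ℕ) (hk : 2 ≤ k) :
    2 * binom (k - 1) (m - 1) - binom k m + binom (k - 2) m = CascadeCode.doubleDim k m := by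
  obtain ⟨K, rfl⟩ := Nat.exists_eq_add_of_le' hk
  have e1 : ((K + 2 : ℕ) : ℤ) - 1 = ((K + 1 : ℕ) : ℤ) := by push_cast; ring
  have e2 : ((K + 2 : ℕ) : ℤ) - 2 = (K : ℤ) := by push_cast; ring
  rw [e1, e2, binom_natCast, binom_natCast]
  match m with
  | 0 => simp [binom, CascadeCode.doubleDim]
  | 1 =>
    have : ((1 : ℕ) : ℤ) - 1 = ((0 : ℕ) : ℤ) := rfl
    rw [this, binom_natCast]
    simp [CascadeCode.doubleDim]
  | m + 2 =>
    have : ((m + 2 : ℕ) : ℤ) - 1 = ((m + 1 : ℕ) : ℤ) := by push_cast; ring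
    rw [this, binom_natCast]
    simp only [CascadeCode.doubleDim, Nat.le_add_left, if_true, Nat.add_sub_cancel]
    rw [Nat.choose_succ_succ' (K + 1) (m + 1), Nat.choose_succ_succ' K m,
      Nat.choose_succ_succ' K (m + 1)]
    push_cast
    ring

lemma sum_binom_eq_cascadeSum (k d : ℕ) (hk : 2 ≤ k) (hkd : k ≤ d) :
    ∑ m ∈ Finset.range (k + 1), ((d : ℤ) - k) ^ (k - m) *
      (2 * binom (k - 1) (m - 1) - binom k m + binom (k - 2) m) =
      CascadeCode.cascadeSum k (d - k) k := by
  rw [CascadeCode.cascadeSum, ← Nat.cast_sub hkd]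
  exact Finset.sum_congr rfl fun m _ => by rw [binom_combination k m hk]

/-! ### Images and products of subspaces, dual vectors -/

section LinearAlgebra

variable {F V W : Type*} [Field F] [AddCommGroup V] [Module F V] [AddCommGroup W] [Module F W]

lemma map_inf_map_of_injOn {f : V →ₗ[F] W} {S A B : Submodule F V}
    (hf : ∀ v ∈ S, f v = 0 → v = 0) (hA : A ≤ S) (hB : B ≤ S) :
    A.map f ⊓ B.map f = (A ⊓ B).map f := by
  refine le_antisymm ?_ (le_inf (Submodule.map_mono inf_le_left) (Submodule.map_mono inf_le_right))
  rintro _ ⟨⟨a, ha, rfl⟩, ⟨b, hb, hab⟩⟩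
  have : b - a = 0 := hf _ (S.sub_mem (hB hb) (hA ha)) (by rw [map_sub, hab, sub_self])
  obtain rfl : b = a := sub_eq_zero.mp this
  exact ⟨b, ⟨ha, hb⟩, rfl⟩

lemma finrank_map_of_injOn {f : V →ₗ[F] W} {S A : Submodule F V}
    (hf : ∀ v ∈ S, f v = 0 → v = 0) (hA : A ≤ S) :
    Module.finrank F (A.map f) = Module.finrank F A := by
  rw [← LinearMap.range_domRestrict]
  refine LinearMap.finrank_range_of_inj ?_
  rw [injective_iff_map_eq_zero]
  exact fun a ha => Subtype.ext (hf a (hA a.2) ha)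

/-- The product of submodules is equivalent to the submodule of the product. -/
def submodulePiEquiv {ι : Type*} {U : ι → Type*} [∀ i, AddCommGroup (U i)] [∀ i, Module F (U i)]
    (S : ∀ i, Submodule F (U i)) : Submodule.pi Set.univ S ≃ₗ[F] (∀ i, S i) where
  toFun x i := ⟨x.1 i, x.2 i trivial⟩
  map_add' _ _ := rfl
  map_smul' _ _ := rfl
  invFun x := ⟨fun i => (x i).1, fun i _ => (x i).2⟩
  left_inv _ := rfl
  right_inv _ := rfl

lemma exists_biorthogonal {ι κ : Type*} [Fintype κ] [DecidableEq ι] {v : ι → κ → F}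
    (h : LinearIndependent F v) (i : ι) : ∃ α : κ → F, ∀ j, α ⬝ᵥ v j = if j = i then 1 else 0 := by
  classical
  obtain ⟨g, hg⟩ := LinearMap.exists_extend ((Finsupp.lapply i).comp h.repr)
  refine ⟨fun x => g (Pi.single x 1), fun j => ?_⟩
  have h1 : g (v j) = if j = i then 1 else 0 := by
    have := LinearMap.congr_fun hg ⟨v j, Submodule.subset_span ⟨j, rfl⟩⟩
    rw [LinearMap.comp_apply, LinearMap.comp_apply, h.repr_eq_single j _ rfl] at this
    simpa [Finsupp.single_apply] using this
  rw [← h1, LinearMap.pi_apply_eq_sum_univ g (v j), dotProduct]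
  refine Finset.sum_congr rfl fun x _ => ?_
  rw [smul_eq_mul, mul_comm]
  congr 3
  funext y
  simp [Pi.single_apply, eq_comm]

end LinearAlgebra

namespace CascadeCode

open Finset

/-! ### Repair spaces of cascade codes -/

section Repair

variable {F : Type*} [Field F] {k μ n d : ℕ} (Ψ : Matrix (Fin n) (Fin d) F)

/-- An encoder row with the signs of a code segment. -/
def signedRow (P : Path d) (f : Fin n) : Fin d → F := fun y => (-1) ^ sig P y * Ψ f y

/-- The repair-encoder matrix is the matrix of exterior multiplication by the signed row; this
brings repair into the exterior algebra. -/
lemma wedge_signedRow (P : Path d) (f : Fin n) {m : ℕ} {w : Finset (Fin d) → F} {I : Finset (Fin d)}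
    (hI : I.card = m + 1) :
    wedge (signedRow Ψ P f) w I = ∑ J ∈ Finset.powersetCard m Finset.univ,
      repairEncoder Ψ f P I J * w J := by
  rw [wedge_apply, Finset.sum_apply]
  simp only [repairEncoder, Finset.sum_mul]
  rw [Finset.sum_comm]
  refine Finset.sum_congr rfl fun y _ => ?_
  simp only [Pi.smul_apply, smul_eq_mul, create, LinearMap.coe_mk, AddHom.coe_mk, signedRow]
  by_cases hy : y ∈ I
  · rw [if_pos hy, Finset.sum_eq_single (I.erase y)]
    · rw [if_pos (by rw [Finset.sdiff_erase hy]; simp), pow_add]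
      ring
    · intro J hJ hne
      rw [if_neg, zero_mul]
      intro h
      apply hne
      have h1 : I.erase y ⊆ J := by
        intro z hz
        obtain ⟨hz1, hz2⟩ := Finset.mem_erase.mp hz
        by_contra hzJ
        have : z ∈ I \ J := Finset.mem_sdiff.mpr ⟨hz2, hzJ⟩
        rw [h] at this
        exact hz1 (Finset.mem_singleton.mp this)
      refine (Finset.eq_of_subset_of_card_le h1 ?_).symm
      rw [(Finset.mem_powersetCard.mp hJ).2, Finset.card_erase_of_mem hy, hI]
      rfl
    · intro h
      refine absurd (Finset.mem_powersetCard.mpr ⟨Finset.subset_univ _, ?_⟩) h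
      rw [Finset.card_erase_of_mem hy, hI]
      rfl
  · rw [if_neg hy, mul_zero, Finset.sum_eq_zero]
    intro J _
    rw [if_neg, zero_mul]
    intro h
    have : y ∈ I \ J := by rw [h]; exact Finset.mem_singleton_self y
    exact hy (Finset.mem_sdiff.mp this).1

variable (k μ) in
/-- Combinations of the content of node `h` in one segment. -/
noncomputable def segComb (h : Fin n) (P : Path d) :
    (Finset (Fin d) → F) →ₗ[F] Module.Dual F (File F k d μ) :=
  ∑ I ∈ Finset.powersetCard (mode μ P) Finset.univ,
    (LinearMap.proj I : (Finset (Fin d) → F) →ₗ[F] F).smulRight (segContent k μ Ψ h P I)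

lemma segComb_apply (h : Fin n) (P : Path d) (u : Finset (Fin d) → F) :
    segComb k μ Ψ h P u = ∑ I ∈ Finset.powersetCard (mode μ P) Finset.univ,
      u I • segContent k μ Ψ h P I := by
  simp [segComb, LinearMap.sum_apply]

variable (k μ d) in
/-- Names of the code segments. -/
abbrev Seg : Type := {P : Path d // IsSegment k μ P}

noncomputable instance : Fintype (Seg k μ d) := Fintype.ofFinite _

variable (k μ) in
/-- Combinations of the content of node `h`. -/
noncomputable def comb (h : Fin n) :
    (Seg k μ d → Finset (Fin d) → F) →ₗ[F] Module.Dual F (File F k d μ) :=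
  ∑ P : Seg k μ d, (segComb k μ Ψ h P.1).comp (LinearMap.proj P)

lemma comb_apply (h : Fin n) (x : Seg k μ d → Finset (Fin d) → F) :
    comb k μ Ψ h x = ∑ P : Seg k μ d, segComb k μ Ψ h P.1 (x P) := by
  simp [comb, LinearMap.sum_apply]

/-- Families of homogeneous functions, one for each segment. -/
def homogFamily (F : Type*) [Field F] (k μ d : ℕ) :
    Submodule F (Seg k μ d → Finset (Fin d) → F) :=
  Submodule.pi Set.univ fun P => homog F d (mode μ P.1)

variable (k μ) in
/-- The coefficients of the repair symbols for node `f`. -/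
def repairFamily (f : Fin n) : Submodule F (Seg k μ d → Finset (Fin d) → F) :=
  Submodule.pi Set.univ fun P =>
    homog F d (mode μ P.1) ⊓ LinearMap.ker (wedge (signedRow Ψ P.1 f))

lemma repairFamily_le (f : Fin n) : repairFamily k μ Ψ f ≤ homogFamily F k μ d :=
  Submodule.pi_mono fun _ _ => inf_le_left

variable {Ψ}

/-- Enlarge `h` to `k` nodes. Their contents are arbitrary, so some file shows a single column in
`h`, and evaluating there isolates one coefficient. -/
lemma comb_injOn (hΨ : IsEncoder k Ψ) (hkd : k ≤ d) (hk : 0 < k) (hkn : k ≤ n) (h : Fin n) :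
    ∀ x ∈ homogFamily F k k d, comb k k Ψ h x = 0 → x = 0 := by
  classical
  intro x hx h0
  obtain ⟨e, he, i, rfl⟩ : ∃ e : Fin k → Fin n, Function.Injective e ∧ ∃ i, e i = h := by
    refine ⟨fun i => Equiv.swap ⟨0, hk.trans_le hkn⟩ h (Fin.castLE hkn i), ?_, ⟨0, hk⟩, ?_⟩
    · exact (Equiv.injective _).comp (Fin.castLE_injective hkn)
    · exact Equiv.swap_apply_left _ _
  funext P I
  by_cases hI : I.card = mode k P.1
  swap
  · exact hx P trivial I hI
  obtain ⟨v, hv⟩ := contentMap_surjective hΨ hkd he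
    (fun p => if p.2 = ⟨(P.1, I), P.2, hI⟩ then 1 else 0)
  have hc : ∀ c, content k k Ψ (e i) c v = if c = ⟨(P.1, I), P.2, hI⟩ then 1 else 0 :=
    fun c => congrFun hv (i, c)
  have h1 := congrArg (fun φ => φ v) h0
  simp only [comb_apply, segComb_apply, LinearMap.sum_apply, LinearMap.smul_apply,
    LinearMap.zero_apply] at h1
  rw [Finset.sum_eq_single P, Finset.sum_eq_single I] at h1
  · have := hc ⟨(P.1, I), P.2, hI⟩
    rw [if_pos rfl] at this
    change segContent k k Ψ (e i) P.1 I v = 1 at this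
    rwa [this, smul_eq_mul, mul_one] at h1
  · intro J hJ hne
    have := hc ⟨(P.1, J), P.2, (Finset.mem_powersetCard.mp hJ).2⟩
    rw [if_neg (by simpa using hne)] at this
    change segContent k k Ψ (e i) P.1 J v = 0 at this
    rw [this, smul_zero]
  · intro h'
    exact absurd (Finset.mem_powersetCard.mpr ⟨Finset.subset_univ _, hI⟩) h'
  · intro Q _ hne
    refine Finset.sum_eq_zero fun J hJ => ?_
    have := hc ⟨(Q.1, J), Q.2, (Finset.mem_powersetCard.mp hJ).2⟩
    rw [if_neg (by
      intro h'
      exact hne (Subtype.ext (congrArg (fun c => c.1.1) h')))] at this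
    change segContent k k Ψ (e i) Q.1 J v = 0 at this
    rw [this, smul_zero]
  · simp

lemma segComb_wedge (h f : Fin n) (P : Path d) {m : ℕ} (hm : mode μ P = m + 1)
    (w : Finset (Fin d) → F) :
    segComb k μ Ψ h P (wedge (signedRow Ψ P f) w) = ∑ J ∈ Finset.powersetCard m Finset.univ,
      w J • ∑ I ∈ Finset.powersetCard (mode μ P) Finset.univ,
        repairEncoder Ψ f P I J • segContent k μ Ψ h P I := by
  rw [segComb_apply]
  simp only [Finset.smul_sum]
  rw [Finset.sum_comm]
  refine Finset.sum_congr rfl fun I hI => ?_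
  rw [wedge_signedRow Ψ P f (((Finset.mem_powersetCard.mp hI).2).trans hm), Finset.sum_smul]
  exact Finset.sum_congr rfl fun J _ => by rw [smul_smul, mul_comm]

/-- The coefficient vectors of repair symbols are the multiples of the signed row, and by exactness
these form the kernel. In mode `0` there are no repair symbols, and the kernel is zero as well. -/
lemma span_repairSymbol (h f : Fin n)
    (hf : ∀ P : Path d, ∃ α : Fin d → F, α ⬝ᵥ signedRow Ψ P f = 1) :
    Submodule.span F (Set.range (repairSymbol k μ Ψ h f)) =
      (repairFamily k μ Ψ f).map (comb k μ Ψ h) := by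
  classical
  apply le_antisymm
  · refine Submodule.span_le.mpr ?_
    rintro _ ⟨⟨⟨P, J⟩, hP, hJ⟩, rfl⟩
    change J.card + 1 = mode μ P at hJ
    have hδ : (Pi.single J 1 : Finset (Fin d) → F) ∈ homog F d J.card := by
      intro I hI
      exact Pi.single_eq_of_ne (by rintro rfl; exact hI rfl) _
    refine ⟨Pi.single ⟨P, hP⟩ (wedge (signedRow Ψ P f) (Pi.single J 1)), ?_, ?_⟩
    · intro Q _
      by_cases hQ : Q = ⟨P, hP⟩
      · subst hQ
        rw [Pi.single_eq_same]
        exact ⟨hJ ▸ wedge_mem hδ _, wedge_wedge_self _ _⟩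
      · rw [Pi.single_eq_of_ne hQ]
        exact Submodule.zero_mem _
    · rw [comb_apply, Finset.sum_eq_single ⟨P, hP⟩, Pi.single_eq_same,
        segComb_wedge h f P hJ.symm, Finset.sum_eq_single J, Pi.single_eq_same, one_smul]
      · rfl
      · intro K _ hK
        rw [Pi.single_eq_of_ne hK, zero_smul]
      · intro h'
        exact absurd (Finset.mem_powersetCard.mpr ⟨Finset.subset_univ _, rfl⟩) h'
      · intro Q _ hQ
        rw [Pi.single_eq_of_ne hQ, map_zero]
      · simp
  · rintro _ ⟨x, hx, rfl⟩
    rw [comb_apply]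
    refine Submodule.sum_mem _ fun P _ => ?_
    obtain ⟨α, hα⟩ := hf P.1
    have hxP : x P ∈ homog F d (mode μ P.1) ⊓ LinearMap.ker (wedge (signedRow Ψ P.1 f)) :=
      hx P trivial
    rcases hm : mode μ P.1 with _ | m
    · rw [hm, homog_zero_inf_ker hα, Submodule.mem_bot] at hxP
      rw [hxP, map_zero]
      exact Submodule.zero_mem _
    · rw [hm, ← map_wedge_homog hα] at hxP
      obtain ⟨w, -, hw⟩ := hxP
      rw [← hw, segComb_wedge h f P.1 hm]
      refine Submodule.sum_mem _ fun J hJ => Submodule.smul_mem _ _ (Submodule.subset_span ?_)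
      exact ⟨⟨(P.1, J), P.2, by rw [(Finset.mem_powersetCard.mp hJ).2, hm]⟩, rfl⟩

lemma signedRow_dotProduct (P : Path d) (f : Fin n) (α : Fin d → F) :
    (fun y => (-1) ^ sig P y * α y) ⬝ᵥ signedRow Ψ P f = α ⬝ᵥ Ψ f := by
  refine Finset.sum_congr rfl fun y _ => ?_
  rw [signedRow, mul_mul_mul_comm, ← pow_add, ← two_mul, pow_mul, neg_one_sq, one_pow, one_mul]

/-- The dimension of the common part of the repair spaces for two nodes. -/
theorem finrank_repair_inf (hΨ : IsEncoder k Ψ) (hk : 2 ≤ k) (hkd : k ≤ d) (hdn : d ≤ n)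
    {h f g : Fin n} (hfg : f ≠ g) :
    (Module.finrank F
      ↥(Submodule.span F (Set.range (repairSymbol k k Ψ h f)) ⊓
        Submodule.span F (Set.range (repairSymbol k k Ψ h g))) : ℤ) = cascadeSum k (d - k) k := by
  -- Only the independence of the rows of `f` and `g` matters here: it supplies the dual vectors for
  -- the contractions.
  have hli := linearIndependent_of_card_le hΨ.full (by simpa using hdn) {f, g}
    (by rw [Finset.card_pair hfg]; omega)
  have hf : f ∈ ({f, g} : Finset (Fin n)) := by simp
  have hg : g ∈ ({f, g} : Finset (Fin n)) := by simp
  obtain ⟨α, hα'⟩ := exists_biorthogonal hli ⟨f, hf⟩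
  obtain ⟨β, hβ'⟩ := exists_biorthogonal hli ⟨g, hg⟩
  have hα : α ⬝ᵥ Ψ f = 1 := (hα' ⟨f, hf⟩).trans (if_pos rfl)
  have hβ : β ⬝ᵥ Ψ g = 1 := (hβ' ⟨g, hg⟩).trans (if_pos rfl)
  have hβf : β ⬝ᵥ Ψ f = 0 := (hβ' ⟨f, hf⟩).trans (if_neg (by simpa using hfg))
  rw [span_repairSymbol h f fun P => ⟨_, (signedRow_dotProduct P f α).trans hα⟩,
    span_repairSymbol h g fun P => ⟨_, (signedRow_dotProduct P g β).trans hβ⟩]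
  have hinj := comb_injOn hΨ hkd (by omega) (hkd.trans hdn) h
  rw [map_inf_map_of_injOn hinj (repairFamily_le Ψ f) (repairFamily_le Ψ g),
    finrank_map_of_injOn hinj (inf_le_left.trans (repairFamily_le Ψ f))]
  have hinf : repairFamily k k Ψ f ⊓ repairFamily k k Ψ g = Submodule.pi Set.univ fun P =>
      (homog F d (mode k P.1) ⊓ LinearMap.ker (wedge (signedRow Ψ P.1 f))) ⊓
        LinearMap.ker (wedge (signedRow Ψ P.1 g)) := by
    ext x
    constructor
    · exact fun hx P hP => ⟨hx.1 P hP, (hx.2 P hP).2⟩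
    · exact fun hx => ⟨fun P hP => (hx P hP).1, fun P hP => ⟨(hx P hP).1.1, (hx P hP).2⟩⟩
  rw [hinf, (submodulePiEquiv _).finrank_eq, Module.finrank_pi_fintype]
  obtain ⟨N, rfl⟩ := Nat.exists_eq_add_of_le' (hk.trans hkd)
  rw [Finset.sum_congr rfl fun P _ => finrank_homog_inf_ker_inf_ker
    ((signedRow_dotProduct P.1 f α).trans hα) ((signedRow_dotProduct P.1 g β).trans hβ)
    ((signedRow_dotProduct P.1 f β).trans hβf) _]
  rw [← sum_doubleDim k k (N + 2) hk hkd]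
  rw [Finset.sum_subtype (segments k k (N + 2)) (fun _ => mem_segments), Nat.cast_sum]

end Repair

end CascadeCode

/-! ### Product-matrix codes -/

namespace ProductMatrix

open Finset

variable {F : Type*} [Field F] {n k : ℕ}

/-- The two symmetric blocks of a data file. -/
def block (v : File F k) (t : Fin 2) : Matrix (Fin (k - 1)) (Fin (k - 1)) F :=
  Matrix.of fun i j => v (t, s(i, j))

lemma dotProduct_block_comm (v : File F k) (t : Fin 2) (x y : Fin (k - 1) → F) :
    x ⬝ᵥ (block v t).mulVec y = y ⬝ᵥ (block v t).mulVec x := by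
  have h : (block v t).transpose = block v t := by
    ext i j
    simp [block, Sym2.eq_swap]
  rw [dotProduct_comm, ← Matrix.vecMul_transpose, h, Matrix.dotProduct_mulVec]

variable (Φ : Matrix (Fin n) (Fin (k - 1)) F) (lam : Fin n → F)

lemma sum_mul_content (h : Fin n) (y : Fin (k - 1) → F) (v : File F k) :
    ∑ j, y j * content Φ lam h j v =
      Φ h ⬝ᵥ (block v 0).mulVec y + lam h * (Φ h ⬝ᵥ (block v 1).mulVec y) := by
  have h1 : ∀ j, content Φ lam h j v =
      ∑ i, Φ h i * block v 0 i j + lam h * ∑ i, Φ h i * block v 1 i j := by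
    intro j
    rw [content, LinearMap.sum_apply, Fintype.sum_sum_type, Finset.mul_sum]
    congr 1
    refine Finset.sum_congr rfl fun i _ => ?_
    change (Matrix.diagonal lam * Φ) h i * v (1, s(i, j)) = _
    rw [Matrix.diagonal_mul, mul_assoc]
    rfl
  have h2 : ∀ t, Φ h ⬝ᵥ (block v t).mulVec y = ∑ j, y j * ∑ i, Φ h i * block v t i j := by
    intro t
    simp only [dotProduct, Matrix.mulVec, Finset.mul_sum]
    rw [Finset.sum_comm]
    exact Finset.sum_congr rfl fun j _ => Finset.sum_congr rfl fun i _ => by ring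
  rw [h2, h2, Finset.mul_sum, ← Finset.sum_add_distrib]
  refine Finset.sum_congr rfl fun j _ => ?_
  rw [h1]
  ring

/-- The data file whose block `t` is `a aᵀ` and whose other block vanishes. -/
def rankOne (t : Fin 2) (a : Fin (k - 1) → F) : File F k :=
  fun p => if p.1 = t then (p.2.map a).mul else 0

lemma block_rankOne_self (t : Fin 2) (a y : Fin (k - 1) → F) :
    (block (rankOne t a) t).mulVec y = (a ⬝ᵥ y) • a := by
  funext i
  simp only [Matrix.mulVec, dotProduct, block, rankOne, Matrix.of_apply, if_true, Sym2.map_mk,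
    Sym2.mul_mk, Pi.smul_apply, smul_eq_mul, Finset.sum_mul]
  exact Finset.sum_congr rfl fun j _ => by ring

lemma block_rankOne_of_ne {t u : Fin 2} (h : u ≠ t) (a : Fin (k - 1) → F) :
    block (rankOne t a) u = 0 := by
  ext i j
  simp [block, rankOne, h]

lemma rankOne_ne_zero (t : Fin 2) {a : Fin (k - 1) → F} (ha : a ≠ 0) : rankOne t a ≠ 0 := by
  obtain ⟨i, hi⟩ := Function.ne_iff.mp ha
  intro h
  have := congrFun h (t, s(i, i))
  simp [rankOne] at this
  exact hi this

lemma content_eq_sum (h : Fin n) (j : Fin (k - 1)) (v : File F k) :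
    content Φ lam h j v = ∑ i, (Pi.single j 1 : Fin (k - 1) → F) i * content Φ lam h i v := by
  simp [Pi.single_apply]

lemma content_rankOne_zero (h : Fin n) (j : Fin (k - 1)) (a : Fin (k - 1) → F) :
    content Φ lam h j (rankOne 0 a) = a j * (Φ h ⬝ᵥ a) := by
  rw [content_eq_sum, sum_mul_content, block_rankOne_self, block_rankOne_of_ne (by decide),
    Matrix.zero_mulVec]
  simp

/-- Moving `a aᵀ` to the second block scales the content of node `h` by `lam h`; this
proportionality is what a cascade code cannot reproduce. -/
lemma content_rankOne_one (h : Fin n) (j : Fin (k - 1)) (a : Fin (k - 1) → F) :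
    content Φ lam h j (rankOne 1 a) = lam h * content Φ lam h j (rankOne 0 a) := by
  rw [content_rankOne_zero, content_eq_sum, sum_mul_content, block_rankOne_self,
    block_rankOne_of_ne (by decide), Matrix.zero_mulVec]
  simp

variable {Φ lam}

lemma IsEncoder.linearIndependent (hΦ : IsEncoder Φ lam) (hn : 2 * k - 2 < n)
    (A : Finset (Fin n)) (hA : A.card ≤ k - 1) : LinearIndependent F (fun i : A => Φ i) :=
  linearIndependent_of_card_le hΦ.top (by rw [Fintype.card_fin]; omega) A hA

lemma IsEncoder.row_ne_zero (hΦ : IsEncoder Φ lam) (hk : 2 < k) (hn : 2 * k - 2 < n) (h : Fin n) :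
    Φ h ≠ 0 :=
  (hΦ.linearIndependent hn {h} (by rw [Finset.card_singleton]; omega)).ne_zero
    ⟨h, Finset.mem_singleton_self h⟩

/-- The symbols stored in a node are linearly independent. -/
lemma IsEncoder.eq_zero_of_sum_content (hΦ : IsEncoder Φ lam) (hk : 2 < k) (hn : 2 * k - 2 < n)
    (h : Fin n) {y : Fin (k - 1) → F} (hy : ∀ v, ∑ j, y j * content Φ lam h j v = 0) : y = 0 := by
  obtain ⟨i, hi⟩ := Function.ne_iff.mp (hΦ.row_ne_zero hk hn h)
  -- On rank-one files the relation becomes a product of two linear forms in `a`. Testing it on two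
  -- unit vectors and their sum works over any field.
  have key : ∀ a : Fin (k - 1) → F, (a ⬝ᵥ y) * (Φ h ⬝ᵥ a) = 0 := by
    intro a
    have := hy (rankOne 0 a)
    rw [sum_mul_content, block_rankOne_self, block_rankOne_of_ne (by decide)] at this
    simpa using this
  have hyi : y i = 0 := by
    have := key (Pi.single i 1)
    simp only [single_dotProduct, dotProduct_single, one_mul, mul_one] at this
    exact (mul_eq_zero.mp this).resolve_right hi
  funext j
  have h1 := key (Pi.single j 1)
  have h2 := key (Pi.single i 1 + Pi.single j 1)
  simp only [add_dotProduct, dotProduct_add, single_dotProduct, dotProduct_single, one_mul,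
    mul_one, hyi, zero_add, mul_add] at h1 h2
  rw [h1, add_zero] at h2
  exact (mul_eq_zero.mp h2).resolve_right hi

lemma IsEncoder.repairSymbol_independent (hΦ : IsEncoder Φ lam) (hk : 2 < k) (hn : 2 * k - 2 < n)
    (h : Fin n) {f g : Fin n} (hfg : f ≠ g) {a b : F}
    (hab : ∀ v, a * repairSymbol Φ lam h f () v = b * repairSymbol Φ lam h g () v) : a = 0 := by
  have h0 : a • Φ f - b • Φ g = 0 := by
    refine hΦ.eq_zero_of_sum_content hk hn h fun v => ?_
    have := hab v
    simp only [repairSymbol, LinearMap.sum_apply, LinearMap.smul_apply, smul_eq_mul,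
      Finset.mul_sum] at this
    simp only [Pi.sub_apply, Pi.smul_apply, smul_eq_mul, sub_mul, Finset.sum_sub_distrib, mul_assoc]
    rw [this, sub_self]
  have hli := hΦ.linearIndependent hn {f, g} (by rw [Finset.card_pair hfg]; omega)
  obtain ⟨α, hα⟩ := exists_biorthogonal hli ⟨f, by simp⟩
  have h1 : α ⬝ᵥ Φ f = 1 := (hα ⟨f, by simp⟩).trans (if_pos rfl)
  have h2 : α ⬝ᵥ Φ g = 0 := (hα ⟨g, by simp⟩).trans (if_neg (by simpa using hfg.symm))
  have := congrArg (α ⬝ᵥ ·) h0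
  simpa [dotProduct_sub, dotProduct_smul, h1, h2] using this

/-- Repair spaces for different nodes meet trivially. -/
theorem IsEncoder.finrank_repair_inf (hΦ : IsEncoder Φ lam) (hk : 2 < k) (hn : 2 * k - 2 < n)
    (N : ℕ) (h : Fin n) {f g : Fin n} (hfg : f ≠ g) :
    Module.finrank F
      ↥(Submodule.span F (Set.range (LinearCode.copies N (repairSymbol Φ lam h f))) ⊓
        Submodule.span F (Set.range (LinearCode.copies N (repairSymbol Φ lam h g)))) = 0 := by
  have hcop : ∀ (f : Fin n) (a : Fin N × Unit → F) (j : Fin N) (v : File F k),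
      (∑ p, a p • LinearCode.copies N (repairSymbol Φ lam h f) p) (Pi.single j v) =
        a (j, ()) * repairSymbol Φ lam h f () v := by
    intro f a j v
    rw [LinearMap.sum_apply, Finset.sum_eq_single (j, ())]
    · simp [LinearCode.copies]
    · rintro ⟨i, u⟩ - hne
      have : i ≠ j := by rintro rfl; exact hne rfl
      simp [LinearCode.copies, Pi.single_eq_of_ne this]
    · simp
  suffices hbot : Submodule.span F (Set.range (LinearCode.copies N (repairSymbol Φ lam h f))) ⊓
      Submodule.span F (Set.range (LinearCode.copies N (repairSymbol Φ lam h g))) ≤ ⊥ by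
    rw [le_bot_iff.mp hbot, finrank_bot]
  rintro x ⟨hx, hx'⟩
  obtain ⟨a, rfl⟩ := (Submodule.mem_span_range_iff_exists_fun F).mp hx
  obtain ⟨b, hb⟩ := (Submodule.mem_span_range_iff_exists_fun F).mp hx'
  refine (Submodule.mem_bot F).mpr (Finset.sum_eq_zero ?_)
  rintro ⟨j, u⟩ -
  have : a (j, ()) = 0 := hΦ.repairSymbol_independent hk hn h hfg (b := b (j, ())) fun v => by
    rw [← hcop f a j v, ← hcop g b j v, hb]
  rw [show a (j, u) = 0 from this, zero_smul]

/-- The symbols of node `h` seen by the repair of `c`, for files that vanish in node `c`. -/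
lemma sum_row_mul_content {c : Fin n} {v : File F k} (hc : ∀ j, content Φ lam c j v = 0)
    (h : Fin n) : ∑ j, Φ c j * content Φ lam h j v =
      (lam h - lam c) * (Φ h ⬝ᵥ (block v 1).mulVec (Φ c)) := by
  -- Vanishing in `c`, tested against `Φ h`, expresses the first block through the second; symmetry
  -- of the blocks then exchanges `c` and `h`.
  have h1 := sum_mul_content Φ lam c (Φ h) v
  simp only [hc, mul_zero, Finset.sum_const_zero] at h1
  rw [sum_mul_content, dotProduct_block_comm v 0, dotProduct_block_comm v 1]
  linear_combination -h1

/-- What `c` reads from `c'` vanishes, and the factor `lam c' - lam c` does not. -/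
lemma dotProduct_block_eq_zero {c c' : Fin n} {v : File F k} (hlam : lam c ≠ lam c')
    (hc : ∀ j, content Φ lam c j v = 0) (hc' : ∀ j, content Φ lam c' j v = 0) :
    Φ c' ⬝ᵥ (block v 1).mulVec (Φ c) = 0 := by
  have h1 := sum_row_mul_content hc c'
  simp only [hc', mul_zero, Finset.sum_const_zero] at h1
  exact (mul_eq_zero.mp h1.symm).resolve_left (sub_ne_zero.mpr hlam.symm)

/-- A relation between the two halves of the encoder rows of all nodes but one is trivial. -/
lemma IsEncoder.eq_zero_of_relation (hΦ : IsEncoder Φ lam) (hn : 2 * k - 2 < n) {c : Fin n}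
    (hc : (c : ℕ) = 0) {x y : Fin (k - 1) → F} (hxy : ∀ h ≠ c, Φ h ⬝ᵥ x = lam h * (Φ h ⬝ᵥ y)) :
    x = 0 ∧ y = 0 := by
  -- The shift by one avoids node `0`, which is `c`.
  let e : Fin (2 * k - 2) → Fin n := fun i => ⟨i + 1, by omega⟩
  have he : Function.Injective e := fun i j hij => by
    have := congrArg Fin.val hij
    exact Fin.ext (by simpa [e] using this)
  have h0 : Sum.elim x (-y) = 0 := by
    refine eq_zero_of_dotProduct_eq_zero (hΦ.full e he)
      (by rw [Fintype.card_sum, Fintype.card_fin, Fintype.card_fin]; omega) fun i => ?_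
    have hne : e i ≠ c := by
      intro h
      have := congrArg Fin.val h
      simp only [e] at this
      omega
    have h1 : encoder Φ lam (e i) = Sum.elim (Φ (e i)) (lam (e i) • Φ (e i)) := by
      funext j
      cases j with
      | inl j => rfl
      | inr j =>
        change (Matrix.diagonal lam * Φ) (e i) j = _
        rw [Matrix.diagonal_mul]
        rfl
    rw [h1, sumElim_dotProduct_sumElim, dotProduct_neg, smul_dotProduct, hxy _ hne, smul_eq_mul,
      add_neg_cancel]
  constructor
  · funext i
    exact congrFun h0 (Sum.inl i)
  · funext i
    have := congrFun h0 (Sum.inr i)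
    simpa using this

lemma exists_orthogonal (Φ : Matrix (Fin n) (Fin (k - 1)) F) (C : Finset (Fin n))
    (hC : C.card < k - 1) : ∃ a : Fin (k - 1) → F, a ≠ 0 ∧ ∀ c ∈ C, Φ c ⬝ᵥ a = 0 := by
  let f : (Fin (k - 1) → F) →ₗ[F] (C → F) := LinearMap.pi fun c => dotProductBilin F F (Φ c)
  have : LinearMap.ker f ≠ ⊥ := LinearMap.ker_ne_bot_of_finrank_lt (by simpa using hC)
  obtain ⟨a, ha, ha0⟩ := Submodule.exists_mem_ne_zero_of_ne_bot this
  exact ⟨a, ha0, fun c hc => congrFun ha ⟨c, hc⟩⟩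

end ProductMatrix

/-! ### Non-equivalence -/

namespace CascadeCode

open Finset

variable {F : Type*} [Field F] {k n d : ℕ} {Ψ : Matrix (Fin n) (Fin d) F}

lemma exists_injective_of_card_le (A : Finset (Fin n)) (hA : A.card ≤ k) (hkn : k ≤ n) :
    ∃ e : Fin k → Fin n, Function.Injective e ∧ ∀ a ∈ A, ∃ i, e i = a := by
  obtain ⟨B, hAB, -, hB⟩ := Finset.exists_subsuperset_card_eq (Finset.subset_univ A) hA
    (by rwa [Finset.card_univ, Fintype.card_fin])
  let e : Fin k ≃ B := (B.equivFinOfCardEq hB).symm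
  refine ⟨fun i => e i, Subtype.val_injective.comp e.injective, fun a ha => ?_⟩
  exact ⟨e.symm ⟨a, hAB ha⟩, by simp⟩

lemma IsEncoder.eq_zero_of_card_le (hΨ : IsEncoder k Ψ) (hkd : k ≤ d) (A : Finset (Fin n))
    (hA : k ≤ A.card) {x : {j : Fin d // (j : ℕ) < k} → F}
    (hx : ∀ a ∈ A, topRow Ψ k a ⬝ᵥ x = 0) : x = 0 := by
  obtain ⟨B, hBA, hB⟩ := Finset.exists_subset_card_eq hA
  let e : Fin k ≃ B := (B.equivFinOfCardEq hB).symm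
  exact hΨ.eq_zero_of_topRow hkd (e := fun i => e i) (Subtype.val_injective.comp e.injective)
    fun i => hx _ (hBA (e i).2)

open Classical in
/-- A vector orthogonal to the top rows of the nodes in `C` is the first nonzero column of a file
that vanishes in all nodes in `C`. -/
lemma exists_file (hΨ : IsEncoder k Ψ) (hkd : k ≤ d) (hkn : k ≤ n) (C : Finset (Fin n))
    (hC : C.card ≤ k) (c₀ : Col k d k) {E : {j : Fin d // (j : ℕ) < k} → F}
    (hE : ∀ h ∈ C, topRow Ψ k h ⬝ᵥ E = 0) :
    ∃ v : File F k d k, (∀ h ∈ C, ∀ c, content k k Ψ h c v = 0) ∧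
      ∀ h (c : Col k d k), colRank k c.1.1 c.1.2 ≤ colRank k c₀.1.1 c₀.1.2 →
        content k k Ψ h c v = if c = c₀ then topRow Ψ k h ⬝ᵥ E else 0 := by
  obtain ⟨e, he, heC⟩ := exists_injective_of_card_le C hC hkn
  obtain ⟨v, hv⟩ := contentMap_surjective hΨ hkd he
    (fun p => if p.2 = c₀ then topRow Ψ k (e p.1) ⬝ᵥ E else 0)
  have hv' : ∀ i c, content k k Ψ (e i) c v = if c = c₀ then topRow Ψ k (e i) ⬝ᵥ E else 0 :=
    fun i c => congrFun hv (i, c)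
  refine ⟨v, fun h hh c => ?_, fun h c hc => ?_⟩
  · obtain ⟨i, rfl⟩ := heC h hh
    rw [hv', hE _ hh, ite_self]
  · have hlow := topEntries_eq_of_content hΨ hkd he v (colRank k c₀.1.1 c₀.1.2) fun c hc i => by
      rw [hv', if_neg (by rintro rfl; exact lt_irrefl _ hc)]
    have hcont : ∀ h, content k k Ψ h c v = topRow Ψ k h ⬝ᵥ topEntries v c := fun h =>
      content_eq_of_lower_eq_zero Ψ h c v fun c' hc' => hlow c' (hc'.trans_le hc)
    have htop : topEntries v c = if c = c₀ then E else 0 := by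
      rw [← sub_eq_zero]
      refine hΨ.eq_zero_of_topRow hkd he fun i => ?_
      rw [dotProduct_sub, ← hcont, hv']
      split_ifs <;> simp
    rw [hcont, htop]
    split_ifs <;> simp

/-- The first nonzero column of two files whose contents are proportional in every node. -/
lemma exists_column {v₀ v₁ : File F k d k} {lam : Fin n → F} {C : Finset (Fin n)}
    (h₁ : ∀ h c, content k k Ψ h c v₁ = lam h * content k k Ψ h c v₀)
    (h₀ : ∀ h ∈ C, ∀ c, content k k Ψ h c v₀ = 0) (hne : v₀ ≠ 0) :
    ∃ E G : {j : Fin d // (j : ℕ) < k} → F, ¬ (E = 0 ∧ G = 0) ∧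
      (∀ h, topRow Ψ k h ⬝ᵥ E = lam h * (topRow Ψ k h ⬝ᵥ G)) ∧
      ∀ h ∈ C, topRow Ψ k h ⬝ᵥ G = 0 := by
  let s : Set (Col k d k) := {c | ¬ (topEntries v₁ c = 0 ∧ topEntries v₀ c = 0)}
  have hs : s.Nonempty := by
    by_contra hs
    refine hne (eq_zero_of_topEntries fun c => ?_)
    by_contra hc
    exact hs ⟨c, fun h => hc h.2⟩
  -- At the least-ranked column where either file has a nonzero top part, the contents of both are
  -- plain products of top parts.
  obtain ⟨c, hc, hmin⟩ := Set.exists_min_image s (fun c => colRank k c.1.1 c.1.2) s.toFinite hs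
  have hlow : ∀ c' : Col k d k, colRank k c'.1.1 c'.1.2 < colRank k c.1.1 c.1.2 →
      topEntries v₁ c' = 0 ∧ topEntries v₀ c' = 0 := by
    intro c' hc'
    by_contra h
    exact absurd (hmin c' h) (not_le.mpr hc')
  have e₁ := fun h => content_eq_of_lower_eq_zero Ψ h c v₁ fun c' hc' => (hlow c' hc').1
  have e₀ := fun h => content_eq_of_lower_eq_zero Ψ h c v₀ fun c' hc' => (hlow c' hc').2
  refine ⟨_, _, hc, fun h => ?_, fun h hh => ?_⟩
  · rw [← e₁, ← e₀, h₁]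
  · rw [← e₀, h₀ h hh]

/-- For any `h` outside the `k - 1` nodes `insert h₀ C`, the vector `E - lam h • G` is orthogonal to
`k` top rows, hence zero. Two such `h` with different `lam h` kill `G`. -/
lemma IsEncoder.eq_zero_of_pencil (hΨ : IsEncoder k Ψ) (hk : 2 ≤ k) (hkd : k ≤ d) (hkn : k < n)
    {lam : Fin n → F} (hlam : Function.Injective lam) {C : Finset (Fin n)} (hC : C.card = k - 2)
    {E G : {j : Fin d // (j : ℕ) < k} → F}
    (hEG : ∀ h, topRow Ψ k h ⬝ᵥ E = lam h * (topRow Ψ k h ⬝ᵥ G))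
    (hG : ∀ h ∈ C, topRow Ψ k h ⬝ᵥ G = 0) {h₀ : Fin n} (hh₀ : h₀ ∉ C)
    (h0 : topRow Ψ k h₀ ⬝ᵥ G = 0) : E = 0 ∧ G = 0 := by
  have hc : (insert h₀ C).card = k - 1 := by
    rw [Finset.card_insert_of_notMem hh₀, hC]
    omega
  have key : ∀ h ∈ (insert h₀ C)ᶜ, E = lam h • G := by
    intro h hh
    rw [← sub_eq_zero]
    have hh' := Finset.mem_compl.mp hh
    refine hΨ.eq_zero_of_card_le hkd (insert h (insert h₀ C))
      (by rw [Finset.card_insert_of_notMem hh', hc]; omega) fun a ha => ?_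
    rw [dotProduct_sub, dotProduct_smul, hEG, smul_eq_mul]
    rcases Finset.mem_insert.mp ha with rfl | ha
    · rw [sub_self]
    · rcases Finset.mem_insert.mp ha with rfl | ha
      · rw [h0, mul_zero, mul_zero, sub_zero]
      · rw [hG a ha, mul_zero, mul_zero, sub_zero]
  obtain ⟨a, ha, b, hb, hab⟩ := Finset.one_lt_card.mp
    (show 1 < ((insert h₀ C)ᶜ).card by rw [Finset.card_compl, hc, Fintype.card_fin]; omega)
  have hG0 : G = 0 := by
    have h1 : (lam a - lam b) • G = 0 := by rw [sub_smul, ← key a ha, ← key b hb, sub_self]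
    exact (smul_eq_zero.mp h1).resolve_left (sub_ne_zero.mpr fun h => hab (hlam h))
  exact ⟨by rw [key a ha, hG0, smul_zero], hG0⟩

/-- Cascade codes are not equivalent to concatenations of product-matrix codes. -/
theorem not_equivalent (hk : 2 < k) (hd : d = 2 * k - 2) (hn : d < n) (hΨ : IsEncoder k Ψ)
    {Φ : Matrix (Fin n) (Fin (k - 1)) F} {lam : Fin n → F}
    (hΦ : ProductMatrix.IsEncoder Φ lam) {N : ℕ} (hN : 0 < N) :
    ¬ LinearCode.Equivalent (content k k Ψ)
      (fun h => LinearCode.copies N (ProductMatrix.content Φ lam h)) := by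
  classical
  rintro ⟨a, b, -, hb, T, S, hST⟩
  have hkd : k ≤ d := by omega
  have hn' : 2 * k - 2 < n := by omega
  have := Fintype.ofFinite (Col k d k)
  let c : Fin n := ⟨0, by omega⟩
  -- The size `k - 2` leaves room for a nonzero `ε` orthogonal to these rows of `Φ`, and needs just
  -- two further nodes to reach `k`.
  let C : Finset (Fin n) := Finset.univ.filter fun h => (h : ℕ) < k - 2
  have hcC : c ∈ C := by simp [C, c]; omega
  have hC : C.card = k - 2 := by
    rw [Fin.card_filter_val_lt]
    omega
  -- Contents correspond.
  have hcont : ∀ h V b' j, S h (fun p => LinearCode.copies a (content k k Ψ h) p V) (b', j) =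
      ProductMatrix.content Φ lam h j.2 (T V b' j.1) := fun h V b' j => congrFun (hST h V) (b', j)
  -- Two proportional files.
  obtain ⟨ε, hε, hεC⟩ := ProductMatrix.exists_orthogonal Φ C (by omega)
  let u : Fin 2 → Fin b → Fin N → ProductMatrix.File F k := fun t =>
    Pi.single ⟨0, hb⟩ (Pi.single ⟨0, hN⟩ (ProductMatrix.rankOne t ε))
  let w : Fin 2 → Fin a → File F k d k := fun t => T.symm (u t)
  have hu : ∀ h b' (j : Fin N × Fin (k - 1)), ProductMatrix.content Φ lam h j.2 (u 1 b' j.1) =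
      lam h * ProductMatrix.content Φ lam h j.2 (u 0 b' j.1) := by
    rintro h b' ⟨i, j⟩
    by_cases hb' : b' = ⟨0, hb⟩
    · subst hb'
      by_cases hi : i = ⟨0, hN⟩
      · subst hi
        simp only [u, Pi.single_eq_same]
        exact ProductMatrix.content_rankOne_one Φ lam h j ε
      · simp [u, Pi.single_eq_of_ne hi]
    · simp [u, Pi.single_eq_of_ne hb']
  have hu0 : ∀ h ∈ C, ∀ b' (j : Fin N × Fin (k - 1)),
      ProductMatrix.content Φ lam h j.2 (u 0 b' j.1) = 0 := by
    rintro h hh b' ⟨i, j⟩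
    by_cases hb' : b' = ⟨0, hb⟩
    · subst hb'
      by_cases hi : i = ⟨0, hN⟩
      · subst hi
        simp only [u, Pi.single_eq_same]
        rw [ProductMatrix.content_rankOne_zero, hεC h hh, mul_zero]
      · simp [u, Pi.single_eq_of_ne hi]
    · simp [u, Pi.single_eq_of_ne hb']
  have hw : ∀ h, (fun p => LinearCode.copies a (content k k Ψ h) p (w 1)) =
      lam h • fun p => LinearCode.copies a (content k k Ψ h) p (w 0) := by
    intro h
    apply (S h).injective
    funext ⟨b', j⟩
    rw [map_smul, Pi.smul_apply, hcont, hcont, T.apply_symm_apply, T.apply_symm_apply, hu,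
      smul_eq_mul]
  have hw0 : ∀ h ∈ C, (fun p => LinearCode.copies a (content k k Ψ h) p (w 0)) = 0 := by
    intro h hh
    apply (S h).injective
    funext ⟨b', j⟩
    rw [map_zero, hcont, T.apply_symm_apply, hu0 h hh]
    rfl
  have hw0ne : w 0 ≠ 0 := by
    intro h
    have h1 : u 0 = 0 := T.symm.map_eq_zero_iff.mp h
    have h2 := congrFun (congrFun h1 ⟨0, hb⟩) ⟨0, hN⟩
    simp only [u, Pi.single_eq_same] at h2
    exact ProductMatrix.rankOne_ne_zero 0 hε h2
  obtain ⟨i₁, hi₁⟩ := Function.ne_iff.mp hw0ne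
  obtain ⟨E, G, hne, hEG, hG⟩ := exists_column (Ψ := Ψ) (lam := lam) (C := C)
    (v₀ := w 0 i₁) (v₁ := w 1 i₁) (fun h col => congrFun (hw h) (i₁, col))
    (fun h hh col => congrFun (hw0 h hh) (i₁, col)) hi₁
  have hE : ∀ h ∈ C, topRow Ψ k h ⬝ᵥ E = 0 := fun h hh => by rw [hEG, hG h hh, mul_zero]
  -- The functionals that the repair of node `c` reads.
  let Y : Fin n → (Fin a × Col k d k → F) →ₗ[F] F := fun h =>
    ∑ j, Φ c j • ((LinearMap.proj ((⟨0, hb⟩, (⟨0, hN⟩, j)) : Fin b × Fin N × Fin (k - 1)) :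
      (Fin b × Fin N × Fin (k - 1) → F) →ₗ[F] F).comp (S h).toLinearMap)
  have hY : ∀ h η, Y h η = ∑ j, Φ c j * S h η (⟨0, hb⟩, (⟨0, hN⟩, j)) := by
    intro h η
    simp [Y, LinearMap.sum_apply]
  let s : Set (Fin n × Fin a × Col k d k) := {q | q.1 ∉ C ∧ Y q.1 (Pi.single q.2 1) ≠ 0}
  have hs : s.Nonempty := by
    by_contra hs
    obtain ⟨j, hj⟩ := Function.ne_iff.mp (hΦ.row_ne_zero hk hn' c)
    let h : Fin n := ⟨k, by omega⟩
    have hh : h ∉ C := by simp [C, h]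
    have h0 : Y h = 0 := by
      refine LinearMap.pi_ext' fun p => LinearMap.ext_ring ?_
      by_contra h1
      exact hs ⟨(h, p), hh, h1⟩
    have h2 := hY h ((S h).symm (Pi.single (⟨0, hb⟩, (⟨0, hN⟩, j)) 1))
    rw [h0, (S h).apply_symm_apply, Finset.sum_eq_single j, Pi.single_eq_same, mul_one] at h2
    · exact hj h2.symm
    · intro j' _ hj'
      rw [Pi.single_eq_of_ne (by simpa using hj'), mul_zero]
    · simp
  -- Contents are controlled only up to the rank of the leading column, so `c₀` is taken last among
  -- the columns on which some `Y h`, `h ∉ C`, depends.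
  obtain ⟨⟨h₀, i₀, c₀⟩, ⟨hh₀, hY₀⟩, hmax⟩ := Set.exists_max_image s
    (fun q => colRank k q.2.2.1.1 q.2.2.1.2) s.toFinite hs
  have key : ∀ {D : {j : Fin d // (j : ℕ) < k} → F}, (∀ h ∈ C, topRow Ψ k h ⬝ᵥ D = 0) →
      ∃ x : Fin (k - 1) → F, (∀ h ∈ C, h ≠ c → Φ h ⬝ᵥ x = 0) ∧
        ∀ h ∉ C, Y h (Pi.single (i₀, c₀) 1) * (topRow Ψ k h ⬝ᵥ D) =
          (lam h - lam c) * (Φ h ⬝ᵥ x) := by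
    intro D hD
    -- For `h ∉ C` only the coordinate `(i₀, c₀)` contributes to `Y h`: other columns up to that
    -- rank have zero content, and later ones have zero coefficient.
    obtain ⟨v, hvC, hv⟩ := exists_file hΨ hkd (by omega) C (by omega) c₀ hD
    let V : Fin a → File F k d k := Pi.single i₀ v
    have hV : ∀ h p, LinearCode.copies a (content k k Ψ h) p V =
        if p.1 = i₀ then content k k Ψ h p.2 v else 0 := by
      rintro h ⟨i, col⟩
      by_cases hi : i = i₀
      · subst hi
        simp [LinearCode.copies, V]
      · simp [LinearCode.copies, V, hi]
    have hVC : ∀ h ∈ C, ∀ j, ProductMatrix.content Φ lam h j (T V ⟨0, hb⟩ ⟨0, hN⟩) = 0 := by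
      intro h hh j
      have h1 : (fun p => LinearCode.copies a (content k k Ψ h) p V) = 0 := by
        funext p
        rw [hV, hvC h hh, ite_self]
        rfl
      have h2 := hcont h V ⟨0, hb⟩ (⟨0, hN⟩, j)
      rw [h1, map_zero] at h2
      exact h2.symm
    refine ⟨(ProductMatrix.block (T V ⟨0, hb⟩ ⟨0, hN⟩) 1).mulVec (Φ c), fun h hh hne => ?_,
      fun h hh => ?_⟩
    · exact ProductMatrix.dotProduct_block_eq_zero (fun h' => hne (hΦ.inj h').symm)
        (hVC c hcC) (hVC h hh)
    · have h1 := hY h (fun p => LinearCode.copies a (content k k Ψ h) p V)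
      simp only [hcont] at h1
      rw [ProductMatrix.sum_row_mul_content (hVC c hcC)] at h1
      have h2 : ∀ η, Y h η = ∑ q, η q • Y h (Pi.single q 1) := fun η => by
        rw [LinearMap.pi_apply_eq_sum_univ (Y h) η]
        refine Finset.sum_congr rfl fun q _ => ?_
        congr 2
        funext p
        simp [Pi.single_apply, eq_comm]
      rw [← h1, h2 (fun p => LinearCode.copies a (content k k Ψ h) p V),
        Finset.sum_eq_single (i₀, c₀)]
      · rw [hV, if_pos rfl, hv h c₀ le_rfl, if_pos rfl, smul_eq_mul, mul_comm]
      · rintro ⟨i, col⟩ - hne'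
        rw [hV]
        by_cases hi : i = i₀
        · rw [if_pos hi]
          by_cases hle : colRank k col.1.1 col.1.2 ≤ colRank k c₀.1.1 c₀.1.2
          · rw [hv h col hle, if_neg (by rintro rfl; exact hne' (by rw [hi])), zero_smul]
          · have h3 : Y h (Pi.single (i, col) 1) = 0 := by
              by_contra h3
              exact hle (hmax (h, i, col) ⟨hh, h3⟩)
            rw [h3, smul_zero]
        · rw [if_neg hi, zero_smul]
      · simp
  obtain ⟨x, hxC, hx⟩ := key hE
  obtain ⟨y, hyC, hy⟩ := key hG
  -- Outside `C` the relation between `E` and `G` passes to `x` and `y`, as both carry the same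
  -- coefficient of `Y h`; on `C` away from `c` both sides vanish.
  have hrel : ∀ h ≠ c, Φ h ⬝ᵥ x = lam h * (Φ h ⬝ᵥ y) := by
    intro h hne
    by_cases hh : h ∈ C
    · rw [hxC h hh hne, hyC h hh hne, mul_zero]
    · have hl : lam h - lam c ≠ 0 := sub_ne_zero.mpr fun h' => hne (hΦ.inj h')
      apply mul_left_cancel₀ hl
      rw [← hx h hh, hEG, mul_left_comm, hy h hh]
      ring
  obtain ⟨-, rfl⟩ := hΦ.eq_zero_of_relation hn' rfl hrel
  have h0 := hy h₀ hh₀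
  rw [dotProduct_zero, mul_zero] at h0
  exact hne (hΨ.eq_zero_of_pencil hk.le hkd (by omega) hΦ.inj hC hEG hG hh₀
    ((mul_eq_zero.mp h0).resolve_left hY₀))

end CascadeCode

theorem mainTheorem6 (F : Type*) [Field F] (n k d : ℕ) (hk : 2 < k) (hd : d = 2 * k - 2)
    (hn : d < n) :
    (∀ Ψ : Matrix (Fin n) (Fin d) F, CascadeCode.IsEncoder k Ψ →
      ∀ h f g : Fin n, h ≠ f → h ≠ g → f ≠ g →
        (Module.finrank F
          ↥(Submodule.span F (Set.range (CascadeCode.repairSymbol k k Ψ h f)) ⊓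
            Submodule.span F (Set.range (CascadeCode.repairSymbol k k Ψ h g))) : ℤ) =
        ∑ m ∈ Finset.range (k + 1), ((d : ℤ) - k) ^ (k - m) *
          (2 * binom (k - 1) (m - 1) - binom k m + binom (k - 2) m)) ∧
    (∀ (Φ : Matrix (Fin n) (Fin (k - 1)) F) (lam : Fin n → F), ProductMatrix.IsEncoder Φ lam →
      ∀ h f g : Fin n, h ≠ f → h ≠ g → f ≠ g →
        Module.finrank F
          ↥(Submodule.span F (Set.range (LinearCode.copies ((k - 1) ^ (k - 1))
              (ProductMatrix.repairSymbol Φ lam h f))) ⊓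
            Submodule.span F (Set.range (LinearCode.copies ((k - 1) ^ (k - 1))
              (ProductMatrix.repairSymbol Φ lam h g)))) = 0) ∧
    (∀ (Ψ : Matrix (Fin n) (Fin d) F) (Φ : Matrix (Fin n) (Fin (k - 1)) F) (lam : Fin n → F),
      CascadeCode.IsEncoder k Ψ → ProductMatrix.IsEncoder Φ lam →
        ¬ LinearCode.Equivalent (CascadeCode.content k k Ψ)
          (fun h => LinearCode.copies ((k - 1) ^ (k - 1)) (ProductMatrix.content Φ lam h))) := by
  have hkd : k ≤ d := by omega
  refine ⟨fun Ψ hΨ h f g _ _ hfg => ?_, fun Φ lam hΦ h f g _ _ hfg => ?_, fun Ψ Φ lam hΨ hΦ => ?_⟩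
  · rw [CascadeCode.finrank_repair_inf hΨ hk.le hkd hn.le hfg,
      sum_binom_eq_cascadeSum k d hk.le hkd]
  · exact hΦ.finrank_repair_inf hk (by omega) _ h hfg
  · exact CascadeCode.not_equivalent hk hd hn hΨ hΦ (Nat.pow_pos (by omega))
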